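/- Conventions. $K$ is a class of models of a fixed vocabulary and $\preceq$ is a binary relation on $K$; $\lambda$ is an infinite cardinal; $K_\mu$ is the class of models in $K$ of cardinality $\mu$. $(K,\preceq)$ is an AEC if: $K$ and $\preceq$ are closed under isomorphisms; $\preceq$ is a partial order contained in the submodel relation; if $M_0\subseteq M_1$, $M_0\preceq M_2$ and $M_1\preceq M_2$ then $M_0\preceq M_1$; for every $\preceq$-increasing continuous sequence $\langle M_\alpha:\alpha<\delta\rangle$ of limit length, the union is in $K$, each $M_\alpha\preceq\bigcup_{\beta<\delta}M_\beta$, and $\bigcup_{\beta<\delta}M_\beta\preceq N$ whenever $M_\alpha\preceq N$ for all $\alpha<\delta$; and there is an LST-number (least $\kappa$ such that for all $A\subseteq N\in K$ there is $M$ with $A\subseteq M\preceq N$ and $\|M\|\le\kappa+|A|$). An AEC in $\mu$ is defined in the same way, but all its models have cardinality $\mu$, only sequences of length $<\mu^+$ are considered, and the LST-number is dropped. An embedding $f:M\to N$ is an isomorphism of $M$ onto some $f[M]\preceq N$. An amalgamation $(f_1,f_2,N_3)$ of $N_1,N_2$ over $M$ consists of embeddings $f_i:N_i\to N_3$ fixing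 $M$ pointwise. For $M\preceq N$ and $a\in N-M$, $tp(a,M,N)$ is the class of $(M,N,a)$ under the transitive closure of: $(M,N_1,a_1)E^*(M,N_2,a_2)$ iff there is an amalgamation $(f_1,f_2,N_3)$ of $N_1,N_2$ over $M$ with $f_1(a_1)=f_2(a_2)$. $S(M)$ is the set of these types. Frames. Let $S^{bs}$ assign to each $M\in K_\mu$ a set of types $S^{bs}(M)\subseteq S(M)$, the basic types, and let $\perp$ be a set of quadruples $(M_0,M_1,a,N)$ with $M_0\preceq M_1\preceq N$ in $K_\mu$, $a\in N-M_1$ and $tp(a,M_0,N)$, $tp(a,M_1,N)$ basic; we then say that $tp(a,M_1,N)$ does not fork over $M_0$. The frame axioms in $\mu$ are: joint embedding in $\mu$; amalgamation in $\mu$; no maximal model of cardinality $\mu$; $S^{bs}$ and $\perp$ are closed under isomorphisms; and (all models being in $K_\mu$) (density) if $M\preceq N$, $M\ne N$, then $tp(a,M,N)$ is basic for some $a\in N-M$; (monotonicity) if $M_0\preceq M_0'\preceq M_1'\preceq M_1$, $N\preceq N'$, $N''\preceq N'$ and $M_1'\cup\{a\}\subseteq N''$, then $(M_0,M_1,a,N)\in\perp$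 implies $(M_0',M_1',a,N'')\in\perp$; (local character) if $\delta<\mu^+$ is limit and $\langle M_\alpha:\alpha\le\delta\rangle$ is increasing continuous, then every basic type over $M_\delta$ does not fork over $M_\alpha$ for some $\alpha<\delta$; (uniqueness) two types over $M_1$ that do not fork over $M_0$ and have the same restriction to $M_0$ are equal; (symmetry) if $M_0\preceq M_1\preceq M_2$, $a\in M_1-M_0$, $tp(a,M_0,M_1)$ is basic and $tp(b,M_1,M_2)$ does not fork over $M_0$, then there are $M_2',M_3$ with $M_0\preceq M_2'\preceq M_3$, $M_2\preceq M_3$, $b\in M_2'$, such that $tp(a,M_2',M_3)$ does not fork over $M_0$; (extension) if $M\preceq N$, every basic type over $M$ extends to a type over $N$ that does not fork over $M$; (continuity) if $\delta<\mu^+$ is limit, $\langle M_\alpha:\alpha\le\delta\rangle$ is increasing continuous, $p\in S(M_\delta)$ and $p\restriction M_\alpha$ does not fork over $M_0$ for every $\alpha<\delta$, then $p$ is basic and does not fork over $M_0$. $\mathfrak s=(K,\preceq,S^{bs},\perp)$ is a semi-good non-forking $\lambda$-frame if $(K,\preceq)$ is an AEC with LST-number at most $\lambda$, the frame axioms in $\lambda$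 hold, and $|S^{bs}(M)|\le\lambda^+$ for $M\in K_\lambda$. A quadruple $(K',\preceq',S',\perp')$ is a good non-forking $\lambda^+$-frame (of the second version) if $(K',\preceq')$ is an AEC in $\lambda^+$, the frame axioms in $\lambda^+$ hold (types being computed in $(K',\preceq')$), and $|S'(M)|\le\lambda^+$ for $M\in K'$. Derived frames. Let $\mathfrak s$ be a semi-good non-forking $\lambda$-frame. $\perp^{\ge\lambda}$ is the class of $(M_0,M_1,a,M_2)$ with $M_0\preceq M_1\preceq M_2$ in $K$, all of cardinality at least $\lambda$, and $a\in M_2-M_1$, such that for some $N_0\in K_\lambda$ with $N_0\preceq M_0$, for every $N\in K_\lambda$ with $N_0\preceq N\preceq M_1$, $tp(a,N,M_2)$ does not fork over $N_0$ in the sense of $\mathfrak s$. A type $p\in S(M)$, $M\in K_{\lambda^+}$, is in $S^{bs}_{\lambda^+}(M)$ if there are $N\in K_\lambda$ with $N\preceq M$ and $(M,M_2,a)\in p$ with $(N,M,a,M_2)\in\perp^{\ge\lambda}$. $\perp_{\lambda^+}$ is the restriction of $\perp^{\ge\lambda}$ to models of cardinality $\lambda^+$, and $\mathfrak s_{\lambda^+}=(K_{\lambda^+},\preceq\restriction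 K_{\lambda^+},S^{bs}_{\lambda^+},\perp_{\lambda^+})$. $K^{sat}$ is the class of $M\in K_{\lambda^+}$ that are saturated in $\lambda^+$ over $\lambda$: for every $N\in K_\lambda$ with $N\preceq M$, each $p\in S(N)$ is $tp(a,N,M)$ for some $a\in M$. Finally $\mathfrak s^{sat}=(K^{sat},\preceq\restriction K^{sat},S^{bs}_{\lambda^+}\restriction K^{sat},\perp_{\lambda^+}\restriction K^{sat})$, where $\perp_{\lambda^+}\restriction K^{sat}$ consists of the quadruples whose three models are in $K^{sat}$. (In $\mathfrak s_{\lambda^+}$ and $\mathfrak s^{sat}$ a type computed in the smaller class counts as basic if the type of the same triple computed in $(K,\preceq)$ is in $S^{bs}_{\lambda^+}(M)$.) Proposition. Let $\lambda$ be an infinite cardinal and let $\mathfrak s=(K,\preceq,S^{bs},\perp)$ be a semi-good non-forking $\lambda$-frame. Assume that $(K^{sat},\preceq\restriction K^{sat})$ is an AEC in $\lambda^+$. If $\mathfrak s_{\lambda^+}$ is a good non-forking $\lambda^+$-frame, then $\mathfrak s^{sat}$ is a good non-forking $\lambda^+$-frame. -/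

import Mathlib

universe u

namespace JardenFrames

open Cardinal
open scoped FirstOrder

/-- A model for the vocabulary `L`: an `L`-structure whose universe is a set (a small class)
of elements of the universe of sets `ZFSet`.  Thus inclusion of models, unions of chains of models
and membership `a ∈ M` have their literal set-theoretic meaning. -/
structure Model (L : FirstOrder.Language.{u, u}) : Type (u + 1) where
  /-- the underlying set -/
  carrier : Set ZFSet.{u}
  /-- it is a set, not a proper class -/
  small : Small.{u} carrier
  /-- the interpretation of the vocabulary -/
  str : L.Structure carrier

variable {L : FirstOrder.Language.{u, u}}

instance (M : Model L) : L.Structure M.carrier := M.str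

instance (M : Model L) : Small.{u} M.carrier := M.small

namespace Model

/-- The cardinality `‖M‖`. -/
noncomputable def card (M : Model L) : Cardinal.{u} := #(Shrink.{u} M.carrier)

/-- `M ⊆ N`: `M` is a submodel (substructure) of `N`. -/
def IsSubmodel (M N : Model L) : Prop :=
  ∃ e : M.carrier ↪[L] N.carrier, ∀ x : M.carrier, (e x : ZFSet.{u}) = x

/-- `f` restricts to an isomorphism of `M` onto `N`; so `N` is the model `f[M]`.  Maps between
models are given by functions on all sets, of which only the restriction to the universe of the
model matters. -/
def IsIso (f : ZFSet.{u} → ZFSet.{u}) (M N : Model L) : Prop :=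
  ∃ e : M.carrier ≃[L] N.carrier, ∀ x : M.carrier, (e x : ZFSet.{u}) = f x

/-- `U` is the union `⋃_{α < δ} M_α` of the models `M_α`, `α < δ`. -/
def IsUnion (M : Ordinal.{u} → Model L) (δ : Ordinal.{u}) (U : Model L) : Prop :=
  U.carrier = {x | ∃ α < δ, x ∈ (M α).carrier} ∧ ∀ α < δ, (M α).IsSubmodel U

end Model

/-- `f` fixes `M` pointwise. -/
def Fixes (f : ZFSet.{u} → ZFSet.{u}) (M : Model L) : Prop :=
  ∀ x ∈ M.carrier, f x = x

/-- A pair `(K, ⪯)`: a class of models together with a binary relation on it. -/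
structure AbsClass (L : FirstOrder.Language.{u, u}) : Type (u + 1) where
  /-- the class `K` -/
  mem : Set (Model L)
  /-- the relation `⪯` -/
  le : Model L → Model L → Prop
  le_mem : ∀ {M N : Model L}, le M N → M ∈ mem ∧ N ∈ mem

namespace AbsClass

/-- `(K ∩ P, ⪯ ↾ (K ∩ P))`. -/
def restrict (C : AbsClass L) (P : Set (Model L)) : AbsClass L where
  mem := {M | M ∈ C.mem ∧ M ∈ P}
  le M N := C.le M N ∧ M ∈ P ∧ N ∈ P
  le_mem h := ⟨⟨(C.le_mem h.1).1, h.2.1⟩, ⟨(C.le_mem h.1).2, h.2.2⟩⟩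

/-- `⟨M_α : α < δ⟩` is a `⪯`-increasing continuous sequence of models in `K`. -/
structure IncrCont (C : AbsClass L) (M : Ordinal.{u} → Model L) (δ : Ordinal.{u}) : Prop where
  mem : ∀ α < δ, M α ∈ C.mem
  le : ∀ α β, α ≤ β → β < δ → C.le (M α) (M β)
  cont : ∀ β < δ, Order.IsSuccLimit β → Model.IsUnion M β (M β)

/-- The requirements on an abstract elementary class apart from the Löwenheim-Skolem-Tarski
property, where chains of limit length `δ` are considered only for `δ` with `len δ`. -/
structure IsAECForLengths (C : AbsClass L) (len : Ordinal.{u} → Prop) : Prop where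
  iso_mem : ∀ (f : ZFSet.{u} → ZFSet.{u}) (M N : Model L),
    M ∈ C.mem → Model.IsIso f M N → N ∈ C.mem
  iso_le : ∀ (f : ZFSet.{u} → ZFSet.{u}) (M₀ M N₀ N : Model L),
    C.le M₀ M → Model.IsIso f M N → Model.IsIso f M₀ N₀ → C.le N₀ N
  sub : ∀ M N : Model L, C.le M N → M.IsSubmodel N
  refl : ∀ M ∈ C.mem, C.le M M
  trans : ∀ M₀ M₁ M₂ : Model L, C.le M₀ M₁ → C.le M₁ M₂ → C.le M₀ M₂
  coherence : ∀ M₀ M₁ M₂ : Model L, M₀.IsSubmodel M₁ → C.le M₀ M₂ → C.le M₁ M₂ → C.le M₀ M₁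
  /-- closure under unions of increasing continuous sequences -/
  union : ∀ (δ : Ordinal.{u}) (M : Ordinal.{u} → Model L) (U : Model L),
    Order.IsSuccLimit δ → len δ → C.IncrCont M δ → Model.IsUnion M δ U →
      U ∈ C.mem ∧ ∀ α < δ, C.le (M α) U
  smooth : ∀ (δ : Ordinal.{u}) (M : Ordinal.{u} → Model L) (U N : Model L),
    Order.IsSuccLimit δ → len δ → C.IncrCont M δ → Model.IsUnion M δ U →
      (∀ α < δ, C.le (M α) N) → C.le U N

/-- The Löwenheim-Skolem-Tarski number of `(K, ⪯)` exists and is at most `κ`. -/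
def LSTAtMost (C : AbsClass L) (κ : Cardinal.{u}) : Prop :=
  ∀ N ∈ C.mem, ∀ A : Set ZFSet.{u}, A ⊆ N.carrier →
    ∃ M : Model L, C.le M N ∧ A ⊆ M.carrier ∧ lift.{u + 1} M.card ≤ lift.{u + 1} κ + #A

/-- `(K, ⪯)` is an abstract elementary class (AEC). -/
def IsAEC (C : AbsClass L) : Prop :=
  C.IsAECForLengths (fun _ => True) ∧ ∃ κ : Cardinal.{u}, C.LSTAtMost κ

/-- `(K, ⪯)` is an AEC in `μ`: all models have cardinality `μ`, and only chains of length less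
than `μ⁺` are considered. -/
def IsAECIn (C : AbsClass L) (μ : Cardinal.{u}) : Prop :=
  (∀ M ∈ C.mem, M.card = μ) ∧ C.IsAECForLengths (fun δ => δ < (Order.succ μ).ord)

/-- `f` is an embedding of `M` into `N` in the sense of `(K, ⪯)`: an isomorphism of `M` onto a
model `f[M]` with `f[M] ⪯ N`. -/
def IsEmb (C : AbsClass L) (f : ZFSet.{u} → ZFSet.{u}) (M N : Model L) : Prop :=
  ∃ M' : Model L, Model.IsIso f M M' ∧ C.le M' N

/-- The class `K_μ` of models in `K` of cardinality `μ`. -/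
def ofCard (C : AbsClass L) (μ : Cardinal.{u}) : Set (Model L) :=
  {M | M ∈ C.mem ∧ M.card = μ}

/-- Joint embedding in `μ`. -/
def JEP (C : AbsClass L) (μ : Cardinal.{u}) : Prop :=
  ∀ M₁ ∈ C.ofCard μ, ∀ M₂ ∈ C.ofCard μ, ∃ M₃ ∈ C.ofCard μ,
    ∃ f₁ f₂ : ZFSet.{u} → ZFSet.{u}, C.IsEmb f₁ M₁ M₃ ∧ C.IsEmb f₂ M₂ M₃

/-- Amalgamation in `μ`. -/
def AP (C : AbsClass L) (μ : Cardinal.{u}) : Prop :=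
  ∀ M₀ ∈ C.ofCard μ, ∀ M₁ ∈ C.ofCard μ, ∀ M₂ ∈ C.ofCard μ, C.le M₀ M₁ → C.le M₀ M₂ →
    ∃ M₃ ∈ C.ofCard μ, ∃ f₁ f₂ : ZFSet.{u} → ZFSet.{u},
      C.IsEmb f₁ M₁ M₃ ∧ C.IsEmb f₂ M₂ M₃ ∧ Fixes f₁ M₀ ∧ Fixes f₂ M₀

/-- There is no maximal model of cardinality `μ`. -/
def NoMax (C : AbsClass L) (μ : Cardinal.{u}) : Prop :=
  ∀ M ∈ C.ofCard μ, ∃ N ∈ C.ofCard μ, C.le M N ∧ M ≠ N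

/-- `(M, N, a)` is a triple with `M ⪯ N` and `a ∈ N - M`. -/
def IsTriple (C : AbsClass L) (M N : Model L) (a : ZFSet.{u}) : Prop :=
  C.le M N ∧ a ∈ N.carrier ∧ a ∉ M.carrier

/-- The relation `(M, N₁, a₁) E* (M, N₂, a₂)`: there is an amalgamation `(f₁, f₂, N₃)` of `N₁` and
`N₂` over `M` with `f₁(a₁) = f₂(a₂)`. -/
def EStar (C : AbsClass L) (M : Model L) (s t : Model L × ZFSet.{u}) : Prop :=
  C.IsTriple M s.1 s.2 ∧ C.IsTriple M t.1 t.2 ∧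
    ∃ (N₃ : Model L) (f₁ f₂ : ZFSet.{u} → ZFSet.{u}),
      C.IsEmb f₁ s.1 N₃ ∧ C.IsEmb f₂ t.1 N₃ ∧ Fixes f₁ M ∧ Fixes f₂ M ∧ f₁ s.2 = f₂ t.2

end AbsClass

/-- Galois types over a fixed model `M` are classes of pairs `(N, a)`, standing for `(M, N, a)`. -/
abbrev GType (L : FirstOrder.Language.{u, u}) : Type (u + 1) := Set (Model L × ZFSet.{u})

namespace AbsClass

/-- The type `tp(a, M, N)` in `(K, ⪯)`: the class of `(M, N, a)` under the transitive closure of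
`E*`. -/
def tp (C : AbsClass L) (M N : Model L) (a : ZFSet.{u}) : GType L :=
  {t | Relation.TransGen (C.EStar M) (N, a) t}

/-- `S(M)`, the non-algebraic types over `M` in `(K, ⪯)`. -/
def types (C : AbsClass L) (M : Model L) : Set (GType L) :=
  {p | ∃ (N : Model L) (a : ZFSet.{u}), C.IsTriple M N a ∧ p = C.tp M N a}

/-- `M` is saturated in `κ⁺` over `κ`. -/
def IsSat (C : AbsClass L) (κ : Cardinal.{u}) (M : Model L) : Prop :=
  M ∈ C.ofCard (Order.succ κ) ∧
    ∀ N ∈ C.ofCard κ, C.le N M → ∀ p ∈ C.types N, ∃ a ∈ M.carrier, a ∉ N.carrier ∧ C.tp N M a = p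

/-- The pair `(K^sat, ⪯ ↾ K^sat)`. -/
def sat (C : AbsClass L) (κ : Cardinal.{u}) : AbsClass L := C.restrict {M | C.IsSat κ M}

end AbsClass

/-- The data `(K, ⪯, S^bs, ⫝)` of a frame.  `nf M₀ M₁ a N` says that the quadruple
`(M₀, M₁, a, N)` is in the non-forking relation. -/
structure Frame (L : FirstOrder.Language.{u, u}) : Type (u + 1) where
  /-- the pair `(K, ⪯)` -/
  C : AbsClass L
  /-- the function `S^bs` -/
  bs : Model L → Set (GType L)
  /-- the relation `⫝` -/
  nf : Model L → Model L → ZFSet.{u} → Model L → Prop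

namespace Frame

/-- The requirements on a non-forking `μ`-frame apart from `(K, ⪯)` being an AEC (or an AEC in
`μ`), with `|S^bs(M)| ≤ θ`. -/
structure IsFrame (F : Frame L) (μ θ : Cardinal.{u}) : Prop where
  jep : F.C.JEP μ
  ap : F.C.AP μ
  noMax : F.C.NoMax μ
  bs_types : ∀ M ∈ F.C.ofCard μ, F.bs M ⊆ F.C.types M
  bs_iso : ∀ (f : ZFSet.{u} → ZFSet.{u}) (M N M' N' : Model L) (a : ZFSet.{u}),
    M ∈ F.C.ofCard μ → F.C.IsTriple M N a → Model.IsIso f N N' → Model.IsIso f M M' →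
      F.C.tp M N a ∈ F.bs M → F.C.tp M' N' (f a) ∈ F.bs M'
  density : ∀ M ∈ F.C.ofCard μ, ∀ N ∈ F.C.ofCard μ, F.C.le M N → M ≠ N →
    ∃ a ∈ N.carrier, a ∉ M.carrier ∧ F.C.tp M N a ∈ F.bs M
  stability : ∀ M ∈ F.C.ofCard μ, #(F.bs M) ≤ lift.{u + 1} θ
  nf_sort : ∀ (M₀ M₁ N : Model L) (a : ZFSet.{u}), F.nf M₀ M₁ a N →
    M₀ ∈ F.C.ofCard μ ∧ M₁ ∈ F.C.ofCard μ ∧ N ∈ F.C.ofCard μ ∧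
      F.C.le M₀ M₁ ∧ F.C.le M₁ N ∧ a ∈ N.carrier ∧ a ∉ M₁.carrier ∧
      F.C.tp M₀ N a ∈ F.bs M₀ ∧ F.C.tp M₁ N a ∈ F.bs M₁
  nf_iso : ∀ (f : ZFSet.{u} → ZFSet.{u}) (M₀ M₁ N M₀' M₁' N' : Model L) (a : ZFSet.{u}),
    F.nf M₀ M₁ a N → Model.IsIso f N N' → Model.IsIso f M₀ M₀' → Model.IsIso f M₁ M₁' →
      F.nf M₀' M₁' (f a) N'
  monotonicity : ∀ (M₀ M₀' M₁' M₁ N N' N'' : Model L) (a : ZFSet.{u}),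
    M₀' ∈ F.C.ofCard μ → M₁' ∈ F.C.ofCard μ → N' ∈ F.C.ofCard μ → N'' ∈ F.C.ofCard μ →
    F.C.le M₀ M₀' → F.C.le M₀' M₁' → F.C.le M₁' M₁ → F.C.le N N' → F.C.le N'' N' →
    M₁'.carrier ⊆ N''.carrier → a ∈ N''.carrier →
      F.nf M₀ M₁ a N → F.nf M₀' M₁' a N''
  localCharacter : ∀ (δ : Ordinal.{u}) (M : Ordinal.{u} → Model L) (N : Model L) (a : ZFSet.{u}),
    Order.IsSuccLimit δ → δ < (Order.succ μ).ord → F.C.IncrCont M (Order.succ δ) →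
    (∀ α ≤ δ, (M α).card = μ) → N ∈ F.C.ofCard μ → F.C.IsTriple (M δ) N a →
    F.C.tp (M δ) N a ∈ F.bs (M δ) → ∃ α < δ, F.nf (M α) (M δ) a N
  uniqueness : ∀ (M₀ M₁ N N' : Model L) (a a' : ZFSet.{u}),
    F.nf M₀ M₁ a N → F.nf M₀ M₁ a' N' →
      F.C.tp M₀ N a = F.C.tp M₀ N' a' → F.C.tp M₁ N a = F.C.tp M₁ N' a'
  symmetry : ∀ (M₀ M₁ M₂ : Model L) (a b : ZFSet.{u}),
    M₀ ∈ F.C.ofCard μ → M₁ ∈ F.C.ofCard μ → M₂ ∈ F.C.ofCard μ → F.C.le M₀ M₁ → F.C.le M₁ M₂ →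
    F.C.IsTriple M₀ M₁ a → F.C.tp M₀ M₁ a ∈ F.bs M₀ → F.nf M₀ M₁ b M₂ →
      ∃ M₂' ∈ F.C.ofCard μ, ∃ M₃ ∈ F.C.ofCard μ, F.C.le M₀ M₂' ∧ F.C.le M₂' M₃ ∧
        F.C.le M₂ M₃ ∧ b ∈ M₂'.carrier ∧ F.nf M₀ M₂' a M₃
  /-- every basic type over `M` has a non-forking extension to a type over `N ⪰ M` -/
  extension : ∀ M ∈ F.C.ofCard μ, ∀ N ∈ F.C.ofCard μ, F.C.le M N → ∀ p ∈ F.bs M,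
    ∃ (N' : Model L) (a : ZFSet.{u}), F.nf M N a N' ∧ F.C.tp M N' a = p
  continuity : ∀ (δ : Ordinal.{u}) (M : Ordinal.{u} → Model L) (N : Model L) (a : ZFSet.{u}),
    Order.IsSuccLimit δ → δ < (Order.succ μ).ord → F.C.IncrCont M (Order.succ δ) →
    (∀ α ≤ δ, (M α).card = μ) → N ∈ F.C.ofCard μ → F.C.IsTriple (M δ) N a →
    (∀ α < δ, F.nf (M 0) (M α) a N) → F.nf (M 0) (M δ) a N

/-- `F` is a semi-good non-forking `κ`-frame: `(K, ⪯)` is an AEC with LST-number at most `κ`, and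
`|S^bs(M)| ≤ κ⁺`. -/
def IsSemiGood (F : Frame L) (κ : Cardinal.{u}) : Prop :=
  F.C.IsAEC ∧ F.C.LSTAtMost κ ∧ F.IsFrame κ (Order.succ κ)

/-- `F` is a good non-forking `μ`-frame of the second version: `(K, ⪯)` is an AEC in `μ`, and
`|S^bs(M)| ≤ μ`. -/
def IsGood₂ (F : Frame L) (μ : Cardinal.{u}) : Prop :=
  F.C.IsAECIn μ ∧ F.IsFrame μ μ

/-- The type `p` over `M₁` does not fork over `M₀` (with respect to the relation `⫝` of the
frame). -/
def NonForking (F : Frame L) (M₀ M₁ : Model L) (p : GType L) : Prop :=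
  ∃ t ∈ p, F.nf M₀ M₁ t.2 t.1

/-- The relation `⫝^{≥ κ}`, extending `⫝` to models of cardinality at least `κ`. -/
def nfGE (F : Frame L) (κ : Cardinal.{u}) (M₀ M₁ : Model L) (a : ZFSet.{u}) (M₂ : Model L) :
    Prop :=
  (κ ≤ M₀.card ∧ κ ≤ M₁.card ∧ κ ≤ M₂.card) ∧
  (F.C.le M₀ M₁ ∧ F.C.le M₁ M₂ ∧ a ∈ M₂.carrier ∧ a ∉ M₁.carrier) ∧
  ∃ N₀ ∈ F.C.ofCard κ, F.C.le N₀ M₀ ∧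
    ∀ N ∈ F.C.ofCard κ, F.C.le N₀ N → F.C.le N M₁ → F.NonForking N₀ N (F.C.tp N M₂ a)

/-- `S^bs_{> κ}(M)`: the types over `M` (in `(K, ⪯)`) that do not fork, in the sense of
`⫝^{≥ κ}`, over some model `N ⪯ M` of cardinality `κ`. -/
def bsGT (F : Frame L) (κ : Cardinal.{u}) (M : Model L) : Set (GType L) :=
  {p | p ∈ F.C.types M ∧
    ∃ N ∈ F.C.ofCard κ, F.C.le N M ∧ ∃ t ∈ p, F.nfGE κ N M t.2 t.1}

/-- The frame induced by a `κ`-frame on a subclass `P` of `K_{> κ}`: its class is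
`(K ∩ P, ⪯ ↾ (K ∩ P))`, its non-forking relation is the restriction of `⫝^{≥ κ}` and its basic types
are the types `tp(a, M, N)` in the restricted class for which `tp(a, M, N)` in the sense of `(K, ⪯)`
is in `S^bs_{> κ}(M)`. -/
def induced (F : Frame L) (κ : Cardinal.{u}) (P : Set (Model L)) : Frame L where
  C := F.C.restrict P
  bs M := {p | ∃ (N : Model L) (a : ZFSet.{u}), (F.C.restrict P).IsTriple M N a ∧
    p = (F.C.restrict P).tp M N a ∧ F.C.tp M N a ∈ F.bsGT κ M}
  nf M₀ M₁ a M₂ := F.nfGE κ M₀ M₁ a M₂ ∧ M₀ ∈ P ∧ M₁ ∈ P ∧ M₂ ∈ P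

/-- The frame `𝔰_{κ⁺}`, on the class `K_{κ⁺}`. -/
def succFrame (F : Frame L) (κ : Cardinal.{u}) : Frame L :=
  F.induced κ (F.C.ofCard (Order.succ κ))

/-- The frame `𝔰^sat`, on the class `K^sat`. -/
def satFrame (F : Frame L) (κ : Cardinal.{u}) : Frame L :=
  F.induced κ {M | F.C.IsSat κ M}

end Frame

end JardenFrames

/-! The saturated models are cofinal above each of their members: if M is saturated and N ⪰ M has
cardinality λ⁺, then some saturated P satisfies N ⪯ P. Indeed a saturated model is model homogeneous
(`IsSat.exists_isEmb`), hence every N of cardinality λ⁺ sharing with M a submodel of cardinality λ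
embeds into M (`IsSat.exists_isEmb_of_succ`). Renaming the elements of M outside the image of N
turns this embedding into an inclusion of N in a copy P of M (`IsSat.exists_extension`). The
embedding need not fix M.

Everything else works for any AEC in λ⁺ on a subclass of K_{λ⁺} with this cofinality
(`IsGood₂.induced`). With amalgamation in λ⁺, equality of types is witnessed by one amalgam of size
λ⁺, which can be enlarged into the subclass; so types are equal in the subclass exactly when they
are equal in K (`tp_restrict_eq_iff`). Non-forking is in both frames a restriction of the same
relation. Hence most axioms transfer at once or after enlarging a witness.

Symmetry is the exception: the witness M₂' lies inside the ambient model, and the type of a over an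
enlargement of M₂' might fork. Extension and uniqueness in 𝔰_{λ⁺} allow the enlargement to be placed
independently of a. -/

namespace JardenFrames

open Cardinal Set
open scoped FirstOrder

variable {L : FirstOrder.Language.{u, u}}

/-! ### Submodels, isomorphic copies and unions of chains of models. -/

namespace Model

theorem lift_card (M : Model L) : lift.{u + 1} M.card = #M.carrier :=
  Cardinal.lift_mk_shrink'' M.carrier

section Submodel

variable {M N P : Model L}

theorem IsSubmodel.subset (h : M.IsSubmodel N) : M.carrier ⊆ N.carrier := by
  obtain ⟨e, he⟩ := h
  intro x hx
  have := (e ⟨x, hx⟩).2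
  rwa [he] at this

theorem IsSubmodel.coe_funMap (h : M.IsSubmodel N) {n : ℕ} (F : L.Functions n)
    (xs : Fin n → M.carrier) (ys : Fin n → N.carrier)
    (hxy : ∀ i, (xs i : ZFSet.{u}) = ys i) :
    ((FirstOrder.Language.Structure.funMap F xs : M.carrier) : ZFSet.{u}) =
      (FirstOrder.Language.Structure.funMap F ys : N.carrier) := by
  obtain ⟨e, he⟩ := h
  have : (e : M.carrier → N.carrier) ∘ xs = ys := funext fun i => Subtype.ext (by
    simp [he, hxy])
  rw [← he, e.map_fun, this]

theorem IsSubmodel.relMap_iff (h : M.IsSubmodel N) {n : ℕ} (R : L.Relations n)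
    (xs : Fin n → M.carrier) (ys : Fin n → N.carrier)
    (hxy : ∀ i, (xs i : ZFSet.{u}) = ys i) :
    FirstOrder.Language.Structure.RelMap R xs ↔ FirstOrder.Language.Structure.RelMap R ys := by
  obtain ⟨e, he⟩ := h
  have : (e : M.carrier → N.carrier) ∘ xs = ys := funext fun i => Subtype.ext (by
    simp [he, hxy])
  rw [← e.map_rel, this]

theorem isSubmodel_of (hsub : M.carrier ⊆ N.carrier)
    (hfun : ∀ {n : ℕ} (F : L.Functions n) (xs : Fin n → M.carrier),
      ((FirstOrder.Language.Structure.funMap F xs : M.carrier) : ZFSet.{u}) =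
        (FirstOrder.Language.Structure.funMap F
          (fun i => (⟨xs i, hsub (xs i).2⟩ : N.carrier)) : N.carrier))
    (hrel : ∀ {n : ℕ} (R : L.Relations n) (xs : Fin n → M.carrier),
      FirstOrder.Language.Structure.RelMap R
        (fun i => (⟨xs i, hsub (xs i).2⟩ : N.carrier)) ↔
          FirstOrder.Language.Structure.RelMap R xs) :
    M.IsSubmodel N :=
  ⟨{ toFun := fun x => ⟨x, hsub x.2⟩
     inj' := fun _ _ h => Subtype.ext (congrArg (fun z : N.carrier => (z : ZFSet.{u})) h)
     map_fun' := fun F xs => Subtype.ext (hfun F xs)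
     map_rel' := fun R xs => hrel R xs }, fun _ => rfl⟩

theorem IsSubmodel.trans (h : M.IsSubmodel N) (h' : N.IsSubmodel P) : M.IsSubmodel P := by
  obtain ⟨e, he⟩ := h
  obtain ⟨e', he'⟩ := h'
  exact ⟨e'.comp e, fun x => by simp [he, he']⟩

theorem IsSubmodel.of_subset (h : M.IsSubmodel P) (h' : N.IsSubmodel P)
    (hsub : M.carrier ⊆ N.carrier) : M.IsSubmodel N :=
  isSubmodel_of hsub
    (fun F xs => (h.coe_funMap F xs (fun i => ⟨xs i, h.subset (xs i).2⟩) fun _ => rfl).trans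
      (h'.coe_funMap F _ _ fun _ => rfl).symm)
    (fun R xs => (h'.relMap_iff R _ (fun i => ⟨xs i, h.subset (xs i).2⟩) fun _ => rfl).trans
      (h.relMap_iff R xs _ fun _ => rfl).symm)

theorem IsSubmodel.antisymm (h : M.IsSubmodel N) (h' : N.IsSubmodel M) : M = N := by
  have hc : M.carrier = N.carrier := h.subset.antisymm h'.subset
  obtain ⟨A, hA, sM⟩ := M
  obtain ⟨B, hB, sN⟩ := N
  obtain rfl : A = B := hc
  congr 1
  refine FirstOrder.Language.Structure.ext ?_ ?_
  · funext n F xs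
    exact Subtype.ext (h.coe_funMap F xs xs fun _ => rfl)
  · funext n R xs
    exact propext (h.relMap_iff R xs xs fun _ => rfl)

end Submodel

section Iso

variable {f g : ZFSet.{u} → ZFSet.{u}} {M N P M₀ N₀ : Model L}

theorem IsIso.bijOn (h : IsIso f M N) : BijOn f M.carrier N.carrier := by
  obtain ⟨e, he⟩ := h
  refine ⟨fun x hx => ?_, fun x hx y hy hxy => ?_, fun y hy => ?_⟩
  · rw [← he ⟨x, hx⟩]
    exact (e _).2
  · have : e ⟨x, hx⟩ = e ⟨y, hy⟩ := Subtype.ext (by rw [he, he]; exact hxy)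
    exact congrArg Subtype.val (e.injective this)
  · obtain ⟨x, hx⟩ := e.surjective ⟨y, hy⟩
    exact ⟨x, x.2, by rw [← he, hx]⟩

theorem IsIso.congr (h : IsIso f M N) (hfg : ∀ x ∈ M.carrier, g x = f x) : IsIso g M N := by
  obtain ⟨e, he⟩ := h
  exact ⟨e, fun x => by rw [he, hfg x x.2]⟩

theorem isIso_id (M : Model L) : IsIso id M M :=
  ⟨FirstOrder.Language.Equiv.refl L _, fun _ => rfl⟩

theorem IsIso.comp (h' : IsIso g N P) (h : IsIso f M N) : IsIso (g ∘ f) M P := by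
  obtain ⟨e, he⟩ := h
  obtain ⟨e', he'⟩ := h'
  exact ⟨e'.comp e, fun x => by simp [he, he']⟩

theorem IsIso.exists_inverse (h : IsIso f M N) :
    ∃ g, IsIso g N M ∧ (∀ x ∈ M.carrier, g (f x) = x) ∧ ∀ y ∈ N.carrier, f (g y) = y := by
  classical
  have hb := h.bijOn
  obtain ⟨e, he⟩ := h
  have key : ∀ y (hy : y ∈ N.carrier), f (e.symm ⟨y, hy⟩) = y := fun y hy => by
    rw [← he]; simp
  refine ⟨fun y => if hy : y ∈ N.carrier then e.symm ⟨y, hy⟩ else y, ⟨e.symm, fun y => ?_⟩,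
    fun x hx => ?_, fun y hy => ?_⟩
  · simp
  · simp only [hb.mapsTo hx, dif_pos]
    exact hb.injOn (Subtype.coe_prop _) hx (key _ _)
  · simp only [hy, dif_pos]
    exact key _ _

theorem IsIso.card_eq (h : IsIso f M N) : M.card = N.card := by
  obtain ⟨e, -⟩ := h
  apply Cardinal.lift_injective.{u + 1}
  rw [lift_card, lift_card]
  exact Cardinal.mk_congr e.toEquiv

theorem IsIso.isSubmodel (h : IsIso f M N) (h₀ : IsIso f M₀ N₀) (hM : M₀.IsSubmodel M) :
    N₀.IsSubmodel N := by
  obtain ⟨e, he⟩ := h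
  obtain ⟨e₀, he₀⟩ := h₀
  obtain ⟨i, hi⟩ := hM
  refine ⟨(e.toEmbedding.comp i).comp e₀.symm.toEmbedding, fun y => ?_⟩
  obtain ⟨x, rfl⟩ := e₀.surjective y
  simp [he, he₀, hi]

theorem isSubmodel_refl (M : Model L) : M.IsSubmodel M :=
  ⟨FirstOrder.Language.Embedding.refl L _, fun _ => rfl⟩

theorem IsIso.unique (h : IsIso f M N) (h' : IsIso f M P) : N = P :=
  (h'.isSubmodel h (isSubmodel_refl M)).antisymm (h.isSubmodel h' (isSubmodel_refl M))

theorem exists_isIso_of_injOn (hf : InjOn f M.carrier) :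
    ∃ N : Model L, IsIso f M N ∧ N.carrier = f '' M.carrier := by
  let e : M.carrier ≃ (f '' M.carrier) := hf.bijOn_image.equiv f
  exact ⟨⟨f '' M.carrier, inferInstance, e.inducedStructure⟩, ⟨e.inducedStructureEquiv,
    fun _ => rfl⟩, rfl⟩

theorem IsIso.exists_restrict (h : IsIso f M N) (hM : M₀.IsSubmodel M) :
    ∃ N₀ : Model L, IsIso f M₀ N₀ :=
  let ⟨N₀, h₀, _⟩ := exists_isIso_of_injOn (h.bijOn.injOn.mono hM.subset)
  ⟨N₀, h₀⟩

/-- Foundation: with A the set of elements of M, an ordered pair (A, x) in A would give the cycle A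
∈ {A} ∈ (A, x) ∈ A. -/
theorem exists_fresh (M : Model L) :
    ∃ h : ZFSet.{u} → ZFSet.{u}, Function.Injective h ∧ ∀ x, h x ∉ M.carrier := by
  let A : ZFSet.{u} := ZFSet.range (fun x : M.carrier => (x : ZFSet.{u}))
  refine ⟨fun x => ZFSet.pair A x, fun x y hxy => (ZFSet.pair_inj.1 hxy).2, fun x hx => ?_⟩
  have h1 : ZFSet.pair A x ∈ A := ZFSet.mem_range.2 ⟨⟨_, hx⟩, rfl⟩
  have h2 : A ∈ ({A} : ZFSet.{u}) := by simp
  have h3 : ({A} : ZFSet.{u}) ∈ ZFSet.pair A x := by simp [ZFSet.pair]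
  exact lt_irrefl _ (((ZFSet.rank_lt_of_mem h2).trans (ZFSet.rank_lt_of_mem h3)).trans
    (ZFSet.rank_lt_of_mem h1))

/-- Elements of N are renamed by the inverse of f, and those of P outside N by fresh sets outside M.
This is the device that later turns embeddings into inclusions. -/
theorem IsIso.exists_extension (h : IsIso f M N) (hN : N.IsSubmodel P) :
    ∃ (Q : Model L) (g k : ZFSet.{u} → ZFSet.{u}), IsIso g Q P ∧ IsIso k P Q ∧ IsIso k N M ∧
      (∀ x ∈ M.carrier, g x = f x) ∧ (∀ x ∈ Q.carrier, k (g x) = x) ∧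
        ∀ y ∈ P.carrier, g (k y) = y := by
  classical
  obtain ⟨k, hk, hkf, hfk⟩ := h.exists_inverse
  obtain ⟨t, ht, htM⟩ := exists_fresh M
  let k' : ZFSet.{u} → ZFSet.{u} := fun y => if y ∈ N.carrier then k y else t y
  have hk'N : ∀ y ∈ N.carrier, k' y = k y := fun y hy => if_pos hy
  have hk' : ∀ y ∉ N.carrier, k' y = t y := fun y hy => if_neg hy
  have hinj : Function.Injective fun y : P.carrier => k' y := by
    rintro ⟨x, hx⟩ ⟨y, hy⟩ hxy
    simp only at hxy
    by_cases h1 : x ∈ N.carrier <;> by_cases h2 : y ∈ N.carrier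
    · rw [hk'N x h1, hk'N y h2] at hxy
      exact Subtype.ext (hk.bijOn.injOn h1 h2 hxy)
    · rw [hk'N x h1, hk' y h2] at hxy
      exact (htM y (hxy ▸ hk.bijOn.mapsTo h1)).elim
    · rw [hk' x h1, hk'N y h2] at hxy
      exact (htM x (hxy ▸ hk.bijOn.mapsTo h2)).elim
    · rw [hk' x h1, hk' y h2] at hxy
      exact Subtype.ext (ht hxy)
  obtain ⟨Q, hQ, -⟩ := exists_isIso_of_injOn (M := P) (f := k')
    (fun x hx y hy hxy => congrArg Subtype.val (@hinj ⟨x, hx⟩ ⟨y, hy⟩ hxy))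
  obtain ⟨g, hg, hgk, hkg⟩ := hQ.exists_inverse
  have hgf : ∀ x ∈ M.carrier, g x = f x := fun x hx => by
    have hfx := h.bijOn.mapsTo hx
    have := hgk (f x) (hN.subset hfx)
    rwa [hk'N _ hfx, hkf x hx] at this
  exact ⟨Q, g, k', hg, hQ, hk.congr hk'N, hgf, hkg, hgk⟩

end Iso

section Union

variable {δ : Ordinal.{u}} {D : Ordinal.{u} → Model L}

theorem exists_isUnion (hδ : Order.IsSuccLimit δ)
    (hD : ∀ α β, α ≤ β → β < δ → (D α).IsSubmodel (D β)) : ∃ U : Model L, IsUnion D δ U := by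
  have hU : {x | ∃ α < δ, x ∈ (D α).carrier} = ⋃ i : Iio δ, (D i).carrier := by
    ext x; simp
  have hpos : (⊥ : Ordinal.{u}) < δ := bot_lt_iff_ne_bot.2 hδ.ne_bot
  have hfin : ∀ {n : ℕ} (xs : Fin n → {x | ∃ α < δ, x ∈ (D α).carrier}),
      ∃ α < δ, ∀ i, (xs i : ZFSet.{u}) ∈ (D α).carrier := by
    intro n xs
    choose β hβ hx using fun i => (xs i).2
    have hlt : Finset.univ.sup β < δ := (Finset.sup_lt_iff hpos).2 fun i _ => hβ i
    exact ⟨_, hlt, fun i => (hD _ _ (Finset.le_sup (Finset.mem_univ i)) hlt).subset (hx i)⟩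
  choose α hα hx using @hfin
  let U : Model L :=
    { carrier := {x | ∃ α < δ, x ∈ (D α).carrier}
      small := by rw [hU]; infer_instance
      str :=
        { funMap := fun F xs => ⟨(FirstOrder.Language.Structure.funMap F
            (fun i => (⟨xs i, hx xs i⟩ : (D (α xs)).carrier)) : (D (α xs)).carrier),
            α xs, hα xs, Subtype.coe_prop _⟩
          RelMap := fun R xs => FirstOrder.Language.Structure.RelMap R
            (fun i => (⟨xs i, hx xs i⟩ : (D (α xs)).carrier)) } }
  refine ⟨U, rfl, fun β hβ => isSubmodel_of (fun x hx => ⟨β, hβ, hx⟩) ?_ ?_⟩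
  · intro n F xs
    let ys : Fin n → {x | ∃ α < δ, x ∈ (D α).carrier} := fun i => ⟨xs i, β, hβ, (xs i).2⟩
    -- The structure on U was read off at the chosen stage `α ys`, which need not be β; the two
    -- stages are compared inside the larger one.
    have hγ : max β (α ys) < δ := max_lt hβ (hα ys)
    have h1 := hD _ _ (le_max_left β (α ys)) hγ
    have h2 := hD _ _ (le_max_right β (α ys)) hγ
    exact (h1.coe_funMap F xs (fun i => ⟨xs i, h1.subset (xs i).2⟩) fun _ => rfl).trans
      (h2.coe_funMap F (fun i => ⟨ys i, hx ys i⟩) _ fun _ => rfl).symm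
  · intro n R xs
    let ys : Fin n → {x | ∃ α < δ, x ∈ (D α).carrier} := fun i => ⟨xs i, β, hβ, (xs i).2⟩
    have hγ : max β (α ys) < δ := max_lt hβ (hα ys)
    have h1 := hD _ _ (le_max_left β (α ys)) hγ
    have h2 := hD _ _ (le_max_right β (α ys)) hγ
    exact (h2.relMap_iff R (fun i => ⟨ys i, hx ys i⟩) (fun i => ⟨xs i, h1.subset (xs i).2⟩)
      fun _ => rfl).trans (h1.relMap_iff R xs _ fun _ => rfl).symm

end Union

end Model

/-! ### Chains by transfinite recursion, and the size of their unions. -/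

/-- Transfinite construction of an increasing sequence that meets `θ` many requirements. -/
theorem exists_chain {X : Type*} (Q : X → Prop) (r : X → X → Prop)
    (hrefl : ∀ x, Q x → r x x) (htrans : ∀ x y z, r x y → r y z → r x z)
    {ι : Type u} {θ : Cardinal.{u}} (hι : #ι ≤ θ) (task : ι → X → Prop)
    {x₀ : X} (hx₀ : Q x₀) (step : ∀ x i, Q x → ∃ y, Q y ∧ r x y ∧ task i y)
    (lim : ∀ δ < θ.ord, Order.IsSuccLimit δ → ∀ F : Ordinal.{u} → X, (∀ α < δ, Q (F α)) →
      (∀ α β, α ≤ β → β < δ → r (F α) (F β)) → ∃ y, Q y ∧ ∀ α < δ, r (F α) y) :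
    ∃ F : Ordinal.{u} → X, (∀ α < θ.ord, Q (F α)) ∧
      (∀ α β, α ≤ β → β < θ.ord → r (F α) (F β)) ∧ ∀ i, ∃ α < θ.ord, task i (F α) := by
  classical
  have hcard : lift.{u + 1} #ι ≤ lift.{u} #(Iio θ.ord) := by
    rw [Cardinal.mk_Iio_ordinal]
    simpa using hι
  -- The requirement i is met at stage `e i`; injectivity leaves at most one requirement per stage.
  obtain ⟨e⟩ := Cardinal.lift_mk_le'.1 hcard
  let T : Ordinal.{u} → X → Prop := fun α x => ∀ i, (e i : Ordinal.{u}) = α → task i x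
  have hT : ∀ x α, Q x → ∃ y, Q y ∧ r x y ∧ T α y := by
    intro x α hx
    by_cases h : ∃ i, (e i : Ordinal.{u}) = α
    · obtain ⟨i, rfl⟩ := h
      obtain ⟨y, hy, hxy, ht⟩ := step x i hx
      refine ⟨y, hy, hxy, fun j hj => ?_⟩
      rwa [e.injective (Subtype.ext hj)]
    · exact ⟨x, hx, hrefl x hx, fun i hi => (h ⟨i, hi⟩).elim⟩
  let S : ∀ α : Ordinal.{u}, (∀ β, β < α → X) → X → Prop := fun α ih y =>
    Q y ∧ (∀ β (hβ : β < α), r (ih β hβ) y) ∧ T α y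
  -- The default value `x₀` is never taken below `θ.ord`: `key` shows that a suitable y exists
  -- there.
  let G : ∀ α : Ordinal.{u}, (∀ β, β < α → X) → X := fun α ih =>
    if h : ∃ y, S α ih y then h.choose else x₀
  let F : Ordinal.{u} → X := Ordinal.lt_wf.fix G
  have hF : ∀ α, F α = G α fun β _ => F β := fun α => Ordinal.lt_wf.fix_eq G α
  have key : ∀ α, α < θ.ord → S α (fun β _ => F β) (F α) := by
    intro α
    induction α using WellFoundedLT.induction with
    | ind α ih =>
      intro hα
      have hmono : ∀ β γ, β ≤ γ → γ < α → r (F β) (F γ) := by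
        intro β γ hβγ hγ
        rcases hβγ.eq_or_lt with rfl | hlt
        · exact hrefl _ (ih β hγ (hγ.trans hα)).1
        · exact (ih γ hγ (hγ.trans hα)).2.1 β hlt
      have hex : ∃ y, S α (fun β _ => F β) y := by
        have hub : ∃ x, Q x ∧ ∀ β < α, r (F β) x := by
          rcases Ordinal.zero_or_succ_or_isSuccLimit α with rfl | ⟨β, rfl⟩ | hlim
          · exact ⟨x₀, hx₀, fun β hβ => (not_lt_bot hβ).elim⟩
          · have hβ : β < Order.succ β := Order.lt_succ β
            exact ⟨F β, (ih β hβ (hβ.trans hα)).1, fun γ hγ =>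
              hmono γ β (Order.lt_succ_iff.1 hγ) hβ⟩
          · exact lim α hα hlim F (fun β hβ => (ih β hβ (hβ.trans hα)).1) hmono
        obtain ⟨x, hx, hxF⟩ := hub
        obtain ⟨y, hy, hxy, ht⟩ := hT x α hx
        exact ⟨y, hy, fun β hβ => htrans _ _ _ (hxF β hβ) hxy, ht⟩
      rw [hF]
      simp only [G, dif_pos hex]
      exact hex.choose_spec
  refine ⟨F, fun α hα => (key α hα).1, fun α β hαβ hβ => ?_, fun i =>
    ⟨e i, (e i).2, (key _ (e i).2).2.2 i rfl⟩⟩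
  rcases hαβ.eq_or_lt with rfl | hlt
  · exact hrefl _ (key α hβ).1
  · exact (key β hβ).2.1 α hlt

theorem Model.IsUnion.card_eq {κ : Cardinal.{u}} (hκ : ℵ₀ ≤ κ) {δ : Ordinal.{u}}
    (hδ : Order.IsSuccLimit δ) (hlt : δ < (Order.succ κ).ord) {D : Ordinal.{u} → Model L}
    (hD : ∀ α < δ, (D α).card = κ) {U : Model L} (hU : Model.IsUnion D δ U) : U.card = κ := by
  have hpos : (⊥ : Ordinal.{u}) < δ := bot_lt_iff_ne_bot.2 hδ.ne_bot
  apply Cardinal.lift_injective.{u + 1}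
  rw [Model.lift_card]
  apply le_antisymm
  · have hc : U.carrier = ⋃ i : Iio δ, (D i).carrier := by
      rw [hU.1]; ext x; simp
    rw [hc]
    have hδκ : #(Iio δ) ≤ lift.{u + 1} κ := by
      rw [Cardinal.mk_Iio_ordinal, Cardinal.lift_le]
      exact Order.lt_succ_iff.1 (Cardinal.lt_ord.1 hlt)
    have hκ' : ℵ₀ ≤ lift.{u + 1} κ := by simpa using hκ
    refine (Cardinal.mk_iUnion_le _).trans ?_
    refine (mul_le_mul' hδκ (ciSup_le' (a := lift.{u + 1} κ) fun i => ?_)).trans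
      (Cardinal.mul_eq_self hκ').le
    rw [← Model.lift_card, hD i i.2]
  · rw [← hD ⊥ hpos, Model.lift_card]
    exact Cardinal.mk_le_mk_of_subset (hU.2 ⊥ hpos).subset

/-! ### Embeddings, amalgamation and unions of chains in an AEC. -/

namespace AbsClass

open Model

variable {C : AbsClass L} {len : Ordinal.{u} → Prop} {f g : ZFSet.{u} → ZFSet.{u}}
  {M N P M₀ N₀ : Model L}

section Embedding

theorem IsEmb.mapsTo (hC : C.IsAECForLengths len) (h : C.IsEmb f M N) :
    MapsTo f M.carrier N.carrier := by
  obtain ⟨M', hf, hle⟩ := h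
  exact hf.bijOn.mapsTo.mono_right (hC.sub _ _ hle).subset

theorem IsEmb.injOn (h : C.IsEmb f M N) : InjOn f M.carrier := by
  obtain ⟨M', hf, -⟩ := h
  exact hf.bijOn.injOn

theorem isEmb_id (h : C.le M N) : C.IsEmb id M N := ⟨M, isIso_id M, h⟩

theorem isEmb_of_isIso (hC : C.IsAECForLengths len) (h : IsIso f M N) (hM : M ∈ C.mem) :
    C.IsEmb f M N :=
  ⟨N, h, hC.refl _ (hC.iso_mem _ _ _ hM h)⟩

theorem IsEmb.le_right (hC : C.IsAECForLengths len) (h : C.IsEmb f M N) (hle : C.le N P) :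
    C.IsEmb f M P := by
  obtain ⟨M', hf, h'⟩ := h
  exact ⟨M', hf, hC.trans _ _ _ h' hle⟩

theorem exists_le_of_isIso (hC : C.IsAECForLengths len) (h : IsIso f N P) (hle : C.le M N) :
    ∃ M', IsIso f M M' ∧ C.le M' P := by
  obtain ⟨M', hM'⟩ := h.exists_restrict (hC.sub _ _ hle)
  exact ⟨M', hM', hC.iso_le f _ _ _ _ hle h hM'⟩

theorem IsEmb.comp (hC : C.IsAECForLengths len) (hg : C.IsEmb g N P) (hf : C.IsEmb f M N) :
    C.IsEmb (g ∘ f) M P := by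
  obtain ⟨M', hM', hle⟩ := hf
  obtain ⟨N', hN', hle'⟩ := hg
  obtain ⟨M'', hM'', hle''⟩ := exists_le_of_isIso hC hN' hle
  exact ⟨M'', hM''.comp hM', hC.trans _ _ _ hle'' hle'⟩

theorem IsEmb.le_left (hC : C.IsAECForLengths len) (h : C.IsEmb f N P) (hle : C.le M N) :
    C.IsEmb f M P :=
  h.comp hC (isEmb_id hle)

theorem IsEmb.codRestrict (hC : C.IsAECForLengths len) (h : C.IsEmb f M N) (hle : C.le N₀ N)
    (hm : MapsTo f M.carrier N₀.carrier) : C.IsEmb f M N₀ := by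
  obtain ⟨M', hf, h'⟩ := h
  refine ⟨M', hf, hC.coherence _ _ _ ((hC.sub _ _ h').of_subset (hC.sub _ _ hle) ?_) h' hle⟩
  rw [← hf.bijOn.image_eq]
  exact hm.image_subset

/-- An embedding extends to an isomorphism from an extension of its domain onto its codomain. -/
theorem IsEmb.exists_extension (hC : C.IsAECForLengths len) (h : C.IsEmb f M N) :
    ∃ (Q : Model L) (g k : ZFSet.{u} → ZFSet.{u}), C.le M Q ∧ IsIso g Q N ∧ IsIso k N Q ∧
      (∀ x ∈ M.carrier, g x = f x) ∧ (∀ x ∈ Q.carrier, k (g x) = x) ∧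
        ∀ y ∈ N.carrier, g (k y) = y := by
  obtain ⟨M', hf, hle⟩ := h
  obtain ⟨Q, g, k, hg, hk, hkM, hgf, hkg, hgk⟩ := hf.exists_extension (hC.sub _ _ hle)
  exact ⟨Q, g, k, hC.iso_le k _ _ _ _ hle hk hkM, hg, hk, hgf, hkg, hgk⟩

theorem ofCard_of_isIso (hC : C.IsAECForLengths len) {θ : Cardinal.{u}} (h : IsIso f M N)
    (hM : M ∈ C.ofCard θ) : N ∈ C.ofCard θ :=
  ⟨hC.iso_mem _ _ _ hM.1 h, h.card_eq ▸ hM.2⟩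

/-- Amalgamation of two embeddings. -/
theorem AP.exists_amalgam (hC : C.IsAECForLengths len) {θ : Cardinal.{u}} (hap : C.AP θ)
    {B X₁ X₂ : Model L} {e₁ e₂ : ZFSet.{u} → ZFSet.{u}} (hB : B ∈ C.ofCard θ)
    (hX₁ : X₁ ∈ C.ofCard θ) (hX₂ : X₂ ∈ C.ofCard θ) (h₁ : C.IsEmb e₁ B X₁)
    (h₂ : C.IsEmb e₂ B X₂) :
    ∃ X ∈ C.ofCard θ, ∃ g₁ g₂ : ZFSet.{u} → ZFSet.{u}, C.IsEmb g₁ X₁ X ∧ C.IsEmb g₂ X₂ X ∧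
      ∀ b ∈ B.carrier, g₁ (e₁ b) = g₂ (e₂ b) := by
  obtain ⟨Y₁, j₁, k₁, hle₁, -, hk₁, hj₁, hkj₁, -⟩ := h₁.exists_extension hC
  obtain ⟨Y₂, j₂, k₂, hle₂, -, hk₂, hj₂, hkj₂, -⟩ := h₂.exists_extension hC
  obtain ⟨X, hX, i₁, i₂, hi₁, hi₂, hf₁, hf₂⟩ := hap B hB Y₁ (ofCard_of_isIso hC hk₁ hX₁) Y₂
    (ofCard_of_isIso hC hk₂ hX₂) hle₁ hle₂
  refine ⟨X, hX, i₁ ∘ k₁, i₂ ∘ k₂, hi₁.comp hC (isEmb_of_isIso hC hk₁ hX₁.1),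
    hi₂.comp hC (isEmb_of_isIso hC hk₂ hX₂.1), fun b hb => ?_⟩
  simp only [Function.comp]
  rw [← hj₁ b hb, ← hj₂ b hb, hkj₁ b ((hC.sub _ _ hle₁).subset hb),
    hkj₂ b ((hC.sub _ _ hle₂).subset hb), hf₁ b hb, hf₂ b hb]

/-- Amalgamation of two embeddings over the codomain of the first one. -/
theorem AP.exists_extension (hC : C.IsAECForLengths len) {θ : Cardinal.{u}} (hap : C.AP θ)
    {B X₁ X₂ : Model L} {e₁ e₂ : ZFSet.{u} → ZFSet.{u}} (hB : B ∈ C.ofCard θ)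
    (hX₁ : X₁ ∈ C.ofCard θ) (hX₂ : X₂ ∈ C.ofCard θ) (h₁ : C.IsEmb e₁ B X₁)
    (h₂ : C.IsEmb e₂ B X₂) :
    ∃ X ∈ C.ofCard θ, C.le X₁ X ∧ ∃ g : ZFSet.{u} → ZFSet.{u}, C.IsEmb g X₂ X ∧
      ∀ b ∈ B.carrier, g (e₂ b) = e₁ b := by
  obtain ⟨X, hX, g₁, g₂, hg₁, hg₂, hg⟩ := hap.exists_amalgam hC hB hX₁ hX₂ h₁ h₂
  obtain ⟨Y, j, k, hle, -, hk, hj, hkj, -⟩ := hg₁.exists_extension hC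
  refine ⟨Y, ofCard_of_isIso hC hk hX, hle, k ∘ g₂,
    (isEmb_of_isIso hC hk hX.1).comp hC hg₂, fun b hb => ?_⟩
  have hb₁ := h₁.mapsTo hC hb
  simp only [Function.comp]
  rw [← hg b hb, ← hj _ hb₁, hkj _ ((hC.sub _ _ hle).subset hb₁)]

end Embedding

section Union

variable {δ : Ordinal.{u}} {D : Ordinal.{u} → Model L} {U : Model L}

/-- The axioms on unions of chains hold for increasing chains that need not be continuous. -/
theorem union_of_increasing (hC : C.IsAECForLengths fun _ => True) (hδ : Order.IsSuccLimit δ)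
    (hD : ∀ α β, α ≤ β → β < δ → C.le (D α) (D β)) (hU : IsUnion D δ U) :
    U ∈ C.mem ∧ (∀ α < δ, C.le (D α) U) ∧ ∀ N, (∀ α < δ, C.le (D α) N) → C.le U N := by
  classical
  induction δ using WellFoundedLT.induction generalizing U with
  | ind δ ih =>
    have hex : ∀ β, Order.IsSuccLimit β ∧ β < δ → ∃ V : Model L, IsUnion D β V := fun β hβ =>
      exists_isUnion hβ.1 fun α γ hαγ hγ => hC.sub _ _ (hD α γ hαγ (hγ.trans hβ.2))
    -- Limit stages are replaced by the union of the earlier ones, which makes the chain continuous.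
    -- The induction hypothesis puts `E β` below `D β` and above all earlier `D α`, so E and D
    -- interleave and have the same union.
    let E : Ordinal.{u} → Model L := fun β =>
      if h : Order.IsSuccLimit β ∧ β < δ then (hex β h).choose else D β
    have hEl : ∀ β, Order.IsSuccLimit β → β < δ → IsUnion D β (E β) := by
      intro β hβ hlt
      simp only [E, dif_pos (And.intro hβ hlt)]
      exact (hex β ⟨hβ, hlt⟩).choose_spec
    have hEn : ∀ β, ¬ Order.IsSuccLimit β → E β = D β := fun β hβ => dif_neg fun h => hβ h.1
    have hIH := fun β (hβ : Order.IsSuccLimit β) (hlt : β < δ) =>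
      ih β hlt hβ (fun α γ hαγ hγ => hD α γ hαγ (hγ.trans hlt)) (hEl β hβ hlt)
    have hED : ∀ β < δ, C.le (E β) (D β) := by
      intro β hlt
      by_cases hβ : Order.IsSuccLimit β
      · exact (hIH β hβ hlt).2.2 _ fun α hα => hD α β hα.le hlt
      · rw [hEn β hβ]; exact hD β β le_rfl hlt
    have hDE : ∀ α β, α < β → β < δ → C.le (D α) (E β) := by
      intro α β hαβ hlt
      by_cases hβ : Order.IsSuccLimit β
      · exact (hIH β hβ hlt).2.1 α hαβ
      · rw [hEn β hβ]; exact hD α β hαβ.le hlt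
    have hEE : ∀ α β, α ≤ β → β < δ → C.le (E α) (E β) := by
      intro α β hαβ hlt
      rcases hαβ.eq_or_lt with rfl | h
      · exact hC.refl _ (C.le_mem (hED _ hlt)).1
      · exact hC.trans _ _ _ (hED α (h.trans hlt)) (hDE α β h hlt)
    have hun : ∀ β, Order.IsSuccLimit β → β ≤ δ →
        {x | ∃ α < β, x ∈ (D α).carrier} = {x | ∃ α < β, x ∈ (E α).carrier} := by
      intro β hβ hle
      ext x
      constructor
      · rintro ⟨α, hα, hx⟩
        have hs : Order.succ α < β := hβ.succ_lt hα
        exact ⟨_, hs, (hC.sub _ _ (hDE α _ (Order.lt_succ α) (hs.trans_le hle))).subset hx⟩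
      · rintro ⟨α, hα, hx⟩
        exact ⟨α, hα, (hC.sub _ _ (hED α (hα.trans_le hle))).subset hx⟩
    have hE : C.IncrCont E δ :=
      { mem := fun α hα => (C.le_mem (hED α hα)).1
        le := hEE
        cont := fun β hlt hβ => ⟨(hEl β hβ hlt).1.trans (hun β hβ hlt.le), fun α hα =>
          hC.sub _ _ (hEE α β hα.le hlt)⟩ }
    have hUE : IsUnion E δ U := ⟨hU.1.trans (hun δ hδ le_rfl), fun α hα =>
      (hC.sub _ _ (hED α hα)).trans (hU.2 α hα)⟩
    obtain ⟨hmem, hle⟩ := hC.union δ E U hδ trivial hE hUE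
    refine ⟨hmem, fun α hα => ?_, fun N hN => ?_⟩
    · have hs : Order.succ α < δ := hδ.succ_lt hα
      exact hC.trans _ _ _ (hDE α _ (Order.lt_succ α) hs) (hle _ hs)
    · exact hC.smooth δ E U N hδ trivial hE hUE fun α hα =>
        hC.trans _ _ _ (hED α hα) (hN α hα)

/-- The union of an increasing chain of embeddings is an embedding. -/
theorem exists_isEmb_union (hC : C.IsAECForLengths fun _ => True) (hδ : Order.IsSuccLimit δ)
    (hD : ∀ α β, α ≤ β → β < δ → C.le (D α) (D β)) (hU : IsUnion D δ U)
    (F : Ordinal.{u} → ZFSet.{u} → ZFSet.{u}) (hF : ∀ α < δ, C.IsEmb (F α) (D α) N)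
    (hFF : ∀ α β, α ≤ β → β < δ → ∀ x ∈ (D α).carrier, F β x = F α x) :
    ∃ f, C.IsEmb f U N ∧ ∀ α < δ, ∀ x ∈ (D α).carrier, f x = F α x := by
  classical
  let f : ZFSet.{u} → ZFSet.{u} := fun x =>
    if h : ∃ α < δ, x ∈ (D α).carrier then F h.choose x else x
  have hf : ∀ α < δ, ∀ x ∈ (D α).carrier, f x = F α x := by
    intro α hα x hx
    have h : ∃ α < δ, x ∈ (D α).carrier := ⟨α, hα, hx⟩
    simp only [f, dif_pos h]
    obtain ⟨hγ, hxγ⟩ := h.choose_spec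
    rcases le_total α h.choose with hle | hle
    · exact hFF _ _ hle hγ x hx
    · exact (hFF _ _ hle hα x hxγ).symm
  have : Nonempty (Model L) := ⟨U⟩
  -- The images `E α` form an increasing chain below N whose union is the image of U, so smoothness
  -- puts that image below N.
  choose! E hE hEN using hF
  have hE' : ∀ α < δ, IsIso f (D α) (E α) := fun α hα => (hE α hα).congr (hf α hα)
  have hinj : InjOn f U.carrier := by
    rw [hU.1]
    rintro x ⟨α, hα, hx⟩ y ⟨β, hβ, hy⟩ hxy
    have hγ : max α β < δ := max_lt hα hβ
    exact (hE' _ hγ).bijOn.injOn ((hC.sub _ _ (hD _ _ (le_max_left α β) hγ)).subset hx)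
      ((hC.sub _ _ (hD _ _ (le_max_right α β) hγ)).subset hy) hxy
  obtain ⟨V, hV, hVc⟩ := exists_isIso_of_injOn hinj
  refine ⟨f, ⟨V, hV, ?_⟩, hf⟩
  refine (union_of_increasing (D := E) hC hδ (fun α β hαβ hβ => hC.iso_le f _ _ _ _
    (hD α β hαβ hβ) (hE' β hβ) (hE' α (hαβ.trans_lt hβ))) ⟨?_, fun α hα =>
      hV.isSubmodel (hE' α hα) (hU.2 α hα)⟩).2.2 N hEN
  rw [hVc, hU.1]
  ext y
  constructor
  · rintro ⟨x, ⟨α, hα, hx⟩, rfl⟩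
    exact ⟨α, hα, (hE' α hα).bijOn.mapsTo hx⟩
  · rintro ⟨α, hα, hy⟩
    obtain ⟨x, hx, rfl⟩ := (hE' α hα).bijOn.surjOn hy
    exact ⟨x, ⟨α, hα, hx⟩, rfl⟩

end Union

end AbsClass

/-! ### Löwenheim-Skolem, Galois types and saturated models. -/

namespace AbsClass

open Model

variable {C : AbsClass L} {len : Ordinal.{u} → Prop} {f g : ZFSet.{u} → ZFSet.{u}}
  {M N P : Model L} {κ θ : Cardinal.{u}} {a b : ZFSet.{u}}

theorem LSTAtMost.exists_le (hl : C.LSTAtMost κ) (hκ : ℵ₀ ≤ κ) (hκθ : κ ≤ θ) (hN : N ∈ C.mem)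
    (hθN : θ ≤ N.card) {A : Set ZFSet.{u}} (hA : A ⊆ N.carrier)
    (hcA : #A ≤ lift.{u + 1} θ) : ∃ M ∈ C.ofCard θ, C.le M N ∧ A ⊆ M.carrier := by
  have hθ : ℵ₀ ≤ lift.{u + 1} θ := by simpa using hκ.trans hκθ
  -- Adding a set B of size θ forces the submodel to have size exactly θ.
  obtain ⟨B, hB, hcB⟩ := Cardinal.le_mk_iff_exists_subset.1
    (show lift.{u + 1} θ ≤ #N.carrier by rw [← lift_card]; exact Cardinal.lift_le.2 hθN)
  obtain ⟨M, hM, hAB, hcM⟩ := hl N hN (A ∪ B) (union_subset hA hB)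
  refine ⟨M, ⟨(C.le_mem hM).1, le_antisymm ?_ ?_⟩, hM, subset_union_left.trans hAB⟩
  · rw [← Cardinal.lift_le.{u + 1}]
    refine hcM.trans (Cardinal.add_le_of_le hθ (Cardinal.lift_le.2 hκθ) ?_)
    exact (Cardinal.mk_union_le A B).trans (Cardinal.add_le_of_le hθ hcA hcB.le)
  · rw [← Cardinal.lift_le.{u + 1}, lift_card, ← hcB]
    exact Cardinal.mk_le_mk_of_subset (subset_union_right.trans hAB)

/-- Löwenheim-Skolem above a submodel and an additional element. -/
theorem LSTAtMost.exists_le_insert (hl : C.LSTAtMost κ) (hκ : ℵ₀ ≤ κ) (hκθ : κ ≤ θ)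
    (hC : C.IsAECForLengths len) (hM : M ∈ C.ofCard θ) (hMN : C.le M N) (ha : a ∈ N.carrier) :
    ∃ M' ∈ C.ofCard θ, C.le M M' ∧ C.le M' N ∧ a ∈ M'.carrier := by
  have hsub := (hC.sub _ _ hMN).subset
  have hcM : #M.carrier = lift.{u + 1} θ := by rw [← lift_card, hM.2]
  have hθ : ℵ₀ ≤ lift.{u + 1} θ := by simpa using hκ.trans hκθ
  obtain ⟨M', hM', hle, hA⟩ := hl.exists_le hκ hκθ (C.le_mem hMN).2
    (A := insert a M.carrier) (by
      rw [← Cardinal.lift_le.{u + 1}, ← hcM, lift_card]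
      exact Cardinal.mk_le_mk_of_subset hsub) (insert_subset ha hsub)
    ((Cardinal.mk_insert_le).trans (Cardinal.add_le_of_le hθ hcM.le (one_lt_aleph0.le.trans hθ)))
  exact ⟨M', hM', hC.coherence _ _ _ ((hC.sub _ _ hMN).of_subset (hC.sub _ _ hle)
    ((subset_insert _ _).trans hA)) hMN hle, hle, hA (mem_insert _ _)⟩

section Types

theorem EStar.refl (hC : C.IsAECForLengths len) (h : C.IsTriple M N a) :
    C.EStar M (N, a) (N, a) :=
  have hid : C.IsEmb id N N := isEmb_id (hC.refl _ (C.le_mem h.1).2)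
  ⟨h, h, N, id, id, hid, hid, fun _ _ => rfl, fun _ _ => rfl, rfl⟩

theorem EStar.symm {s t : Model L × ZFSet.{u}} (h : C.EStar M s t) : C.EStar M t s := by
  obtain ⟨hs, ht, N₃, f₁, f₂, h₁, h₂, hf₁, hf₂, h⟩ := h
  exact ⟨ht, hs, N₃, f₂, f₁, h₂, h₁, hf₂, hf₁, h.symm⟩

theorem transGen_symm {s t : Model L × ZFSet.{u}} (h : Relation.TransGen (C.EStar M) s t) :
    Relation.TransGen (C.EStar M) t s := by
  induction h with
  | single h => exact .single h.symm
  | tail _ h ih => exact .head h.symm ih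

theorem tp_eq_iff (hC : C.IsAECForLengths len) (h : C.IsTriple M P b) :
    C.tp M N a = C.tp M P b ↔ Relation.TransGen (C.EStar M) (N, a) (P, b) := by
  refine ⟨fun h' => ?_, fun h' => Set.ext fun t => ⟨fun ht => ?_, fun ht => h'.trans ht⟩⟩
  · have : (P, b) ∈ C.tp M P b := .single (EStar.refl hC h)
    rwa [← h'] at this
  · exact (transGen_symm h').trans ht

/-- Models in an amalgamation can be replaced by smaller ones. -/
theorem EStar.exists_amalgam (hC : C.IsAECForLengths len) (hl : C.LSTAtMost κ) (hκ : ℵ₀ ≤ κ)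
    (hκθ : κ ≤ θ) {s t : Model L × ZFSet.{u}} (h : C.EStar M s t) (hN : N ∈ C.ofCard θ)
    (hP : P ∈ C.ofCard θ) (hNs : C.le N s.1) (hPt : C.le P t.1) :
    ∃ X ∈ C.ofCard θ, ∃ f₁ f₂ : ZFSet.{u} → ZFSet.{u}, C.IsEmb f₁ N X ∧ C.IsEmb f₂ P X ∧
      Fixes f₁ M ∧ Fixes f₂ M ∧ f₁ s.2 = f₂ t.2 := by
  obtain ⟨-, -, Y, f₁, f₂, h₁, h₂, hf₁, hf₂, hst⟩ := h
  have h₁' := h₁.le_left hC hNs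
  have h₂' := h₂.le_left hC hPt
  have hθ : ℵ₀ ≤ lift.{u + 1} θ := by simpa using hκ.trans hκθ
  have hcN : #N.carrier = lift.{u + 1} θ := by rw [← lift_card, hN.2]
  have hcP : #P.carrier = lift.{u + 1} θ := by rw [← lift_card, hP.2]
  have hY : Y ∈ C.mem := by
    obtain ⟨_, _, h⟩ := h₁
    exact (C.le_mem h).2
  obtain ⟨X, hX, hXY, hA⟩ := hl.exists_le hκ hκθ hY
    (A := f₁ '' N.carrier ∪ f₂ '' P.carrier) (by
      rw [← Cardinal.lift_le.{u + 1}, ← hcN, lift_card,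
        ← Cardinal.mk_image_eq_of_injOn _ _ h₁'.injOn]
      exact Cardinal.mk_le_mk_of_subset (h₁'.mapsTo hC).image_subset)
    (union_subset (h₁'.mapsTo hC).image_subset (h₂'.mapsTo hC).image_subset)
    ((Cardinal.mk_union_le _ _).trans (Cardinal.add_le_of_le hθ
      (Cardinal.mk_image_le.trans hcN.le) (Cardinal.mk_image_le.trans hcP.le)))
  exact ⟨X, hX, f₁, f₂, h₁'.codRestrict hC hXY (mapsTo_iff_image_subset.2
      (subset_union_left.trans hA)), h₂'.codRestrict hC hXY (mapsTo_iff_image_subset.2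
      (subset_union_right.trans hA)), hf₁, hf₂, hst⟩

/-- With amalgamation in `θ`, equality of types over models of size `θ` is witnessed by a single
amalgamation of size `θ`. -/
theorem exists_amalgam_of_transGen (hC : C.IsAECForLengths len) (hl : C.LSTAtMost κ)
    (hκ : ℵ₀ ≤ κ) (hκθ : κ ≤ θ) (hap : C.AP θ) (hM : M ∈ C.ofCard θ) (hN : N ∈ C.ofCard θ)
    {t : Model L × ZFSet.{u}} (h : Relation.TransGen (C.EStar M) (N, a) t)
    (hP : P ∈ C.ofCard θ) (hPt : C.le P t.1) (hMP : C.le M P) (ht : t.2 ∈ P.carrier) :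
    ∃ X ∈ C.ofCard θ, ∃ f₁ f₂ : ZFSet.{u} → ZFSet.{u}, C.IsEmb f₁ N X ∧ C.IsEmb f₂ P X ∧
      Fixes f₁ M ∧ Fixes f₂ M ∧ f₁ a = f₂ t.2 := by
  induction h generalizing P with
  | single h => exact h.exists_amalgam hC hl hκ hκθ hN hP (hC.refl _ hN.1) hPt
  | @tail s t _ h ih =>
    -- The intermediate model `s.1` may be too large for amalgamation in θ, so it is cut down to Q
    -- of size θ around M and `s.2`. The amalgams on its two sides are then glued over Q.
    obtain ⟨Q, hQ, hMQ, hQs, hsQ⟩ := hl.exists_le_insert hκ hκθ hC hM h.1.1 h.1.2.1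
    obtain ⟨X₁, hX₁, f₁, f₂, h₁, h₂, hf₁, hf₂, hf⟩ := ih hQ hQs hMQ hsQ
    obtain ⟨X₂, hX₂, g₁, g₂, h₁', h₂', hg₁, hg₂, hg⟩ :=
      h.exists_amalgam hC hl hκ hκθ hQ hP hQs hPt
    obtain ⟨X, hX, hX₁X, i, hi, hif⟩ := hap.exists_extension hC hQ hX₁ hX₂ h₂ h₁'
    refine ⟨X, hX, f₁, i ∘ g₂, h₁.le_right hC hX₁X, hi.comp hC h₂', hf₁, fun x hx => ?_, ?_⟩ <;>
      simp only [Function.comp]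
    · have := hif x ((hC.sub _ _ hMQ).subset hx)
      rw [hg₁ x hx, hf₂ x hx] at this
      rw [hg₂ x hx, this]
    · rw [hf, ← hif _ hsQ, hg]

end Types

section Saturated

/-- Saturated models are model homogeneous. -/
theorem IsSat.exists_isEmb (hC : C.IsAECForLengths fun _ => True) (hl : C.LSTAtMost κ)
    (hκ : ℵ₀ ≤ κ) (hap : C.AP κ) (hM : C.IsSat κ M) {N₀ N₁ : Model L} (hN₀ : N₀ ∈ C.ofCard κ)
    (hN₁ : N₁ ∈ C.ofCard κ) (h₀ : C.le N₀ M) (h₁ : C.le N₀ N₁) :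
    ∃ f, C.IsEmb f N₁ M ∧ Fixes f N₀ := by
  -- States (A, B, f) approximate the inverse of the desired embedding: A ⪯ M, B ⪰ N₁ and f maps A
  -- into B. Once the range of f covers N₁, the inverse of f embeds N₁ into M. The conditions on N₀
  -- and N₁ are part of Q because the chain is not required to start at `x₀`.
  let Q : Model L × Model L × (ZFSet.{u} → ZFSet.{u}) → Prop := fun x =>
    x.1 ∈ C.ofCard κ ∧ x.2.1 ∈ C.ofCard κ ∧ C.le x.1 M ∧ C.le N₀ x.1 ∧ C.le N₁ x.2.1 ∧
      C.IsEmb x.2.2 x.1 x.2.1 ∧ Fixes x.2.2 N₀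
  let r : Model L × Model L × (ZFSet.{u} → ZFSet.{u}) →
      Model L × Model L × (ZFSet.{u} → ZFSet.{u}) → Prop := fun x y =>
    C.le x.1 y.1 ∧ C.le x.2.1 y.2.1 ∧ ∀ c ∈ x.1.carrier, y.2.2 c = x.2.2 c
  have hrefl : ∀ x, Q x → r x x := fun x hx =>
    ⟨hC.refl _ hx.1.1, hC.refl _ hx.2.1.1, fun _ _ => rfl⟩
  have htrans : ∀ x y z, r x y → r y z → r x z := fun x y z hxy hyz =>
    ⟨hC.trans _ _ _ hxy.1 hyz.1, hC.trans _ _ _ hxy.2.1 hyz.2.1, fun c hc =>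
      (hyz.2.2 c ((hC.sub _ _ hxy.1).subset hc)).trans (hxy.2.2 c hc)⟩
  have lim : ∀ δ < (Order.succ κ).ord, Order.IsSuccLimit δ →
      ∀ F : Ordinal.{u} → Model L × Model L × (ZFSet.{u} → ZFSet.{u}),
      (∀ α < δ, Q (F α)) → (∀ α β, α ≤ β → β < δ → r (F α) (F β)) →
        ∃ y, Q y ∧ ∀ α < δ, r (F α) y := by
    intro δ hlt hδ F hQ hr
    have hpos : (⊥ : Ordinal.{u}) < δ := bot_lt_iff_ne_bot.2 hδ.ne_bot
    have hA := fun α β hαβ hβ => (hr α β hαβ hβ).1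
    have hB := fun α β hαβ hβ => (hr α β hαβ hβ).2.1
    obtain ⟨A, hAu⟩ := exists_isUnion hδ fun α β hαβ hβ => hC.sub _ _ (hA α β hαβ hβ)
    obtain ⟨B, hBu⟩ := exists_isUnion hδ fun α β hαβ hβ => hC.sub _ _ (hB α β hαβ hβ)
    obtain ⟨hAm, hAle, hAM⟩ := union_of_increasing hC hδ hA hAu
    obtain ⟨hBm, hBle, -⟩ := union_of_increasing hC hδ hB hBu
    obtain ⟨f, hf, hfF⟩ := exists_isEmb_union hC hδ hA hAu (fun α => (F α).2.2)
      (fun α hα => (hQ α hα).2.2.2.2.2.1.le_right hC (hBle α hα))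
      (fun α β hαβ hβ => (hr α β hαβ hβ).2.2)
    obtain ⟨hQA, hQB, hQ1, hQ2, hQ3, hQ4, hQ5⟩ := hQ ⊥ hpos
    refine ⟨(A, B, f), ⟨⟨hAm, hAu.card_eq hκ hδ hlt fun α hα => (hQ α hα).1.2⟩,
      ⟨hBm, hBu.card_eq hκ hδ hlt fun α hα => (hQ α hα).2.1.2⟩,
      hAM M fun α hα => (hQ α hα).2.2.1, hC.trans _ _ _ hQ2 (hAle ⊥ hpos),
      hC.trans _ _ _ hQ3 (hBle ⊥ hpos), hf, fun x hx => ?_⟩,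
      fun α hα => ⟨hAle α hα, hBle α hα, hfF α hα⟩⟩
    exact (hfF ⊥ hpos x ((hC.sub _ _ hQ2).subset hx)).trans (hQ5 x hx)
  have step : ∀ (x : Model L × Model L × (ZFSet.{u} → ZFSet.{u})) (i : Shrink.{u} N₁.carrier),
      Q x → ∃ y, Q y ∧ r x y ∧
        ((equivShrink N₁.carrier).symm i : ZFSet.{u}) ∈ y.2.2 '' y.1.carrier := by
    rintro ⟨A, B, f⟩ i hx
    have hQx := hx
    obtain ⟨hA, hB, hAM, hN₀A, hN₁B, hf, hf₀⟩ := hx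
    simp only at hA hB hAM hN₀A hN₁B hf hf₀
    set c : ZFSet.{u} := ((equivShrink N₁.carrier).symm i).1
    have hcB : c ∈ B.carrier := (hC.sub _ _ hN₁B).subset (Subtype.coe_prop _)
    by_cases hc : c ∈ f '' A.carrier
    · exact ⟨(A, B, f), hQx, hrefl _ hQx, hc⟩
    -- To put c in the range, B is pulled back to R ⪰ A, and saturation realizes in M, by b, the
    -- type over A of the preimage of c.
    obtain ⟨R, g, k, hAR, hg, hk, hgf, hkg, hgk⟩ := hf.exists_extension hC
    have hR : R ∈ C.ofCard κ := ofCard_of_isIso hC hk hB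
    have hkc : k c ∉ A.carrier := fun h => hc ⟨k c, h, by rw [← hgf _ h, hgk c hcB]⟩
    have htr : C.IsTriple A R (k c) := ⟨hAR, hk.bijOn.mapsTo hcB, hkc⟩
    obtain ⟨b, hbM, hbA, hb⟩ := hM.2 A hA hAM _ ⟨R, k c, htr, rfl⟩
    obtain ⟨A', hA', hAA', hA'M, hbA'⟩ := hl.exists_le_insert hκ le_rfl hC hA hAM hbM
    have hT := (tp_eq_iff hC ⟨hAM, hbM, hbA⟩).1 hb.symm
    obtain ⟨X, hX, f₁, f₂, h₁, h₂, hf₁, hf₂, h₁₂⟩ :=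
      exists_amalgam_of_transGen hC hl hκ le_rfl hap hA hR hT hA' hA'M hAA' hbA'
    -- The amalgam X, which identifies b with the preimage of c, is copied to an extension Y of B.
    -- The model B has to grow, since A' may contain more than A and b.
    obtain ⟨Y, g', k', hBY, -, hk', hg', hkg', -⟩ :=
      (h₁.comp hC (isEmb_of_isIso hC hk hB.1)).exists_extension hC
    have hval : ∀ z ∈ B.carrier, k' (f₁ (k z)) = z := fun z hz => by
      have := hkg' z ((hC.sub _ _ hBY).subset hz)
      rwa [hg' z hz] at this
    have hext : ∀ x ∈ A.carrier, (k' ∘ f₂) x = f x := fun x hx => by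
      have hkf : k (f x) = x := by
        rw [← hgf x hx, hkg x ((hC.sub _ _ hAR).subset hx)]
      have := hval (f x) (hf.mapsTo hC hx)
      rw [hkf, hf₁ x hx] at this
      simp only [Function.comp]
      rw [hf₂ x hx, this]
    have hkf : C.IsEmb (k' ∘ f₂) A' Y := (isEmb_of_isIso hC hk' hX.1).comp hC h₂
    refine ⟨(A', Y, k' ∘ f₂), ⟨hA', ofCard_of_isIso hC hk' hX, hA'M, hC.trans _ _ _ hN₀A hAA',
      hC.trans _ _ _ hN₁B hBY, hkf, fun x hx => ?_⟩,
      ⟨hAA', hBY, hext⟩, b, hbA', ?_⟩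
    · exact (hext x ((hC.sub _ _ hN₀A).subset hx)).trans (hf₀ x hx)
    · simp only [Function.comp]
      simp only at h₁₂
      rw [← h₁₂, hval c hcB]
  have hlt : κ.ord < (Order.succ κ).ord := Cardinal.ord_lt_ord.2 (Order.lt_succ κ)
  obtain ⟨F, hQ, hr, hT⟩ := exists_chain Q r hrefl htrans (ι := Shrink.{u} N₁.carrier) (θ := κ)
    (show #_ ≤ κ from hN₁.2.le) _ (x₀ := (N₀, N₁, id))
    ⟨hN₀, hN₁, h₀, hC.refl _ hN₀.1, hC.refl _ hN₁.1, isEmb_id h₁, fun _ _ => rfl⟩ step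
    (fun δ hδ => lim δ (hδ.trans hlt))
  -- Only κ many requirements arise, so the limit step also applies to the whole chain, whose length
  -- `κ.ord` is below `(Order.succ κ).ord`.
  obtain ⟨⟨A, B, f⟩, ⟨hA, hB, hAM, hN₀A, hN₁B, hf, hf₀⟩, hFr⟩ :=
    lim κ.ord hlt (Cardinal.isSuccLimit_ord hκ) F hQ hr
  simp only at hA hB hAM hN₀A hN₁B hf hf₀
  obtain ⟨D, hD, hDB⟩ := hf
  obtain ⟨k, hk, hkf, -⟩ := hD.exists_inverse
  have hsub : N₁.carrier ⊆ D.carrier := by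
    intro x hx
    obtain ⟨α, hα, y, hy, hyx⟩ := hT (equivShrink _ ⟨x, hx⟩)
    simp only [Equiv.symm_apply_apply] at hyx
    rw [← hyx, ← (hFr α hα).2.2 y hy]
    exact hD.bijOn.mapsTo ((hC.sub _ _ (hFr α hα).1).subset hy)
  have hle : C.le N₁ D :=
    hC.coherence _ _ _ ((hC.sub _ _ hN₁B).of_subset (hC.sub _ _ hDB) hsub) hN₁B hDB
  refine ⟨k, ((isEmb_of_isIso hC hk (C.le_mem hDB).1).le_left hC hle).le_right hC hAM,
    fun x hx => ?_⟩
  have := hkf x ((hC.sub _ _ hN₀A).subset hx)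
  rwa [hf₀ x hx] at this

/-- Saturated models are universal over submodels of size `κ`. -/
theorem IsSat.exists_isEmb_of_succ (hC : C.IsAECForLengths fun _ => True) (hl : C.LSTAtMost κ)
    (hκ : ℵ₀ ≤ κ) (hap : C.AP κ) (hM : C.IsSat κ M) (hN : N ∈ C.ofCard (Order.succ κ))
    {N₀ : Model L} (hN₀ : N₀ ∈ C.ofCard κ) (h₀ : C.le N₀ M) (h₁ : C.le N₀ N) :
    ∃ f, C.IsEmb f N M := by
  let Q : Model L × (ZFSet.{u} → ZFSet.{u}) → Prop := fun x =>
    x.1 ∈ C.ofCard κ ∧ C.le x.1 N ∧ C.IsEmb x.2 x.1 M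
  let r : Model L × (ZFSet.{u} → ZFSet.{u}) → Model L × (ZFSet.{u} → ZFSet.{u}) → Prop :=
    fun x y => C.le x.1 y.1 ∧ ∀ c ∈ x.1.carrier, y.2 c = x.2 c
  have hrefl : ∀ x, Q x → r x x := fun x hx => ⟨hC.refl _ hx.1.1, fun _ _ => rfl⟩
  have htrans : ∀ x y z, r x y → r y z → r x z := fun x y z hxy hyz =>
    ⟨hC.trans _ _ _ hxy.1 hyz.1, fun c hc =>
      (hyz.2 c ((hC.sub _ _ hxy.1).subset hc)).trans (hxy.2 c hc)⟩
  have lim : ∀ δ < (Order.succ κ).ord, Order.IsSuccLimit δ →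
      ∀ F : Ordinal.{u} → Model L × (ZFSet.{u} → ZFSet.{u}),
      (∀ α < δ, Q (F α)) → (∀ α β, α ≤ β → β < δ → r (F α) (F β)) →
        ∃ y, Q y ∧ ∀ α < δ, r (F α) y := by
    intro δ hlt hδ F hQ hr
    have hA := fun α β hαβ hβ => (hr α β hαβ hβ).1
    obtain ⟨A, hAu⟩ := exists_isUnion hδ fun α β hαβ hβ => hC.sub _ _ (hA α β hαβ hβ)
    obtain ⟨hAm, hAle, hAN⟩ := union_of_increasing hC hδ hA hAu
    obtain ⟨f, hf, hfF⟩ := exists_isEmb_union hC hδ hA hAu (fun α => (F α).2)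
      (fun α hα => (hQ α hα).2.2) (fun α β hαβ hβ => (hr α β hαβ hβ).2)
    exact ⟨(A, f), ⟨⟨hAm, hAu.card_eq hκ hδ hlt fun α hα => (hQ α hα).1.2⟩,
      hAN N fun α hα => (hQ α hα).2.1, hf⟩, fun α hα => ⟨hAle α hα, hfF α hα⟩⟩
  have step : ∀ (x : Model L × (ZFSet.{u} → ZFSet.{u})) (i : Shrink.{u} N.carrier),
      Q x → ∃ y, Q y ∧ r x y ∧ ((equivShrink N.carrier).symm i : ZFSet.{u}) ∈ y.1.carrier := by
    rintro ⟨A, f⟩ i ⟨hA, hAN, hf⟩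
    simp only at hA hAN hf
    obtain ⟨A', hA', hAA', hA'N, hiA'⟩ := hl.exists_le_insert hκ le_rfl hC hA hAN
      (Subtype.coe_prop ((equivShrink N.carrier).symm i))
    obtain ⟨D, hD, hDM⟩ := hf
    obtain ⟨k, hk, hkf, -⟩ := hD.exists_inverse
    have hDc := ofCard_of_isIso hC hD hA
    -- R is a copy of A' extending the image D of A; model homogeneity of M over D then extends f to
    -- A'.
    obtain ⟨R, g, k₂, hDR, hg, hk₂, hgk, hkg, -⟩ :=
      ((isEmb_of_isIso hC hk hDc.1).le_right hC hAA').exists_extension hC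
    obtain ⟨h, hh, hh₀⟩ := hM.exists_isEmb hC hl hκ hap hDc (ofCard_of_isIso hC hk₂ hA') hDM hDR
    have hhk : C.IsEmb (h ∘ k₂) A' M := hh.comp hC (isEmb_of_isIso hC hk₂ hA'.1)
    refine ⟨(A', h ∘ k₂), ⟨hA', hA'N, hhk⟩,
      ⟨hAA', fun c hc => ?_⟩, hiA'⟩
    have hfc := hD.bijOn.mapsTo hc
    have : k₂ c = f c := by
      rw [← hkg (f c) ((hC.sub _ _ hDR).subset hfc), hgk _ hfc, hkf c hc]
    simp only [Function.comp]
    rw [this, hh₀ _ hfc]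
  obtain ⟨F, hQ, hr, hT⟩ := exists_chain Q r hrefl htrans (ι := Shrink.{u} N.carrier)
    (θ := Order.succ κ) (show #_ ≤ Order.succ κ from hN.2.le) _ (x₀ := (N₀, id))
    ⟨hN₀, h₁, isEmb_id h₀⟩ step lim
  have hδ := Cardinal.isSuccLimit_ord (hκ.trans (Order.le_succ κ))
  have hA := fun α β hαβ hβ => (hr α β hαβ hβ).1
  obtain ⟨U, hU⟩ := exists_isUnion hδ fun α β hαβ hβ => hC.sub _ _ (hA α β hαβ hβ)
  have hUN := (union_of_increasing hC hδ hA hU).2.2 N fun α hα => (hQ α hα).2.1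
  obtain ⟨f, hf, -⟩ := exists_isEmb_union hC hδ hA hU (fun α => (F α).2)
    (fun α hα => (hQ α hα).2.2) (fun α β hαβ hβ => (hr α β hαβ hβ).2)
  have hNU : N.carrier ⊆ U.carrier := by
    intro x hx
    obtain ⟨α, hα, hxα⟩ := hT (equivShrink _ ⟨x, hx⟩)
    simp only [Equiv.symm_apply_apply] at hxα
    exact (hU.2 α hα).subset hxα
  have : U = N := (hC.sub _ _ hUN).antisymm
    ((isSubmodel_refl N).of_subset (hC.sub _ _ hUN) hNU)
  exact ⟨f, this ▸ hf⟩

/-- Every extension of a saturated model has a saturated extension. -/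
theorem IsSat.exists_extension (hC : C.IsAECForLengths fun _ => True) (hl : C.LSTAtMost κ)
    (hκ : ℵ₀ ≤ κ) (hap : C.AP κ) (hsat : (C.sat κ).IsAECForLengths len) (hM : C.IsSat κ M)
    (hN : N ∈ C.ofCard (Order.succ κ)) (hMN : C.le M N) : ∃ P, C.IsSat κ P ∧ C.le N P := by
  obtain ⟨N₀, hN₀, hle, -⟩ := hl.exists_le (θ := κ) hκ le_rfl hM.1.1
    (hM.1.2 ▸ Order.le_succ κ) (empty_subset M.carrier) (by simp)
  obtain ⟨f, hf⟩ := hM.exists_isEmb_of_succ hC hl hκ hap hN hN₀ hle (hC.trans _ _ _ hle hMN)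
  obtain ⟨P, g, k, hNP, -, hk, -⟩ := hf.exists_extension hC
  -- P is isomorphic to M, and saturation passes to P by the isomorphism axiom for the class of
  -- saturated models.
  exact ⟨P, (hsat.iso_mem k M P ⟨hM.1.1, hM⟩ hk).2, hNP⟩

end Saturated

end AbsClass

/-! ### Comparison of types in a class and in a cofinal subclass. -/

namespace AbsClass

open Model

variable {C : AbsClass L} {len len' : Ordinal.{u} → Prop} {f : ZFSet.{u} → ZFSet.{u}}
  {M N N' : Model L} {κ θ : Cardinal.{u}} {a a' : ZFSet.{u}} {P : Set (Model L)}

theorem IsEmb.le_of_fixes (h : C.IsEmb f M N) (hf : Fixes f M) : C.le M N := by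
  obtain ⟨M', hM', hle⟩ := h
  rwa [hM'.unique ((isIso_id M).congr hf)] at hle

theorem isEmb_restrict_iff (hR : (C.restrict P).IsAECForLengths len) (hM : M ∈ (C.restrict P).mem)
    (hN : N ∈ P) : (C.restrict P).IsEmb f M N ↔ C.IsEmb f M N := by
  constructor
  · rintro ⟨M', hM', hle⟩
    exact ⟨M', hM', hle.1⟩
  · rintro ⟨M', hM', hle⟩
    exact ⟨M', hM', hle, (hR.iso_mem _ _ _ hM hM').2, hN⟩

/-- Equality of types is the same in `C` and in a class of models of size `θ` that is cofinal above
its members. -/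
theorem tp_restrict_eq_iff (hC : C.IsAECForLengths len) (hl : C.LSTAtMost κ) (hκ : ℵ₀ ≤ κ)
    (hκθ : κ ≤ θ) (hap : C.AP θ) (hR : (C.restrict P).IsAECForLengths len')
    (hP : ∀ M ∈ P, M ∈ C.ofCard θ)
    (hcof : ∀ M ∈ P, ∀ N ∈ C.ofCard θ, C.le M N → ∃ N' ∈ P, C.le N N')
    (h : (C.restrict P).IsTriple M N a) (h' : (C.restrict P).IsTriple M N' a') :
    (C.restrict P).tp M N a = (C.restrict P).tp M N' a' ↔ C.tp M N a = C.tp M N' a' := by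
  rw [tp_eq_iff hR h', tp_eq_iff hC ⟨h'.1.1, h'.2⟩]
  refine ⟨Relation.TransGen.mono ?_ _ _, fun hT => ?_⟩
  · rintro s t ⟨hs, ht, Y, f₁, f₂, ⟨_, hi₁, hl₁⟩, ⟨_, hi₂, hl₂⟩, hf⟩
    exact ⟨⟨hs.1.1, hs.2⟩, ⟨ht.1.1, ht.2⟩, Y, f₁, f₂, ⟨_, hi₁, hl₁.1⟩, ⟨_, hi₂, hl₂.1⟩, hf⟩
  · have hN' := hP _ h'.1.2.2
    obtain ⟨X, hX, f₁, f₂, h₁, h₂, hf₁, hf₂, hf⟩ := exists_amalgam_of_transGen hC hl hκ hκθ hap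
      (hP _ h.1.2.1) (hP _ h.1.2.2) hT hN' (hC.refl _ hN'.1) h'.1.1 h'.2.1
    -- Cofinality is available only above members of P; X qualifies because the embedding fixes M,
    -- so that M ⪯ X.
    obtain ⟨Y, hY, hXY⟩ := hcof M h.1.2.1 X hX ((h₁.le_left hC h.1.1).le_of_fixes hf₁)
    exact .single ⟨h, h', Y, f₁, f₂,
      (isEmb_restrict_iff hR ((C.restrict P).le_mem h.1).2 hY).2 (h₁.le_right hC hXY),
      (isEmb_restrict_iff hR ((C.restrict P).le_mem h'.1).2 hY).2 (h₂.le_right hC hXY),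
      hf₁, hf₂, hf⟩

theorem mem_ofCard_restrict_iff (hP : ∀ M ∈ P, M ∈ C.ofCard θ) :
    M ∈ (C.restrict P).ofCard θ ↔ M ∈ P :=
  ⟨fun h => h.1.2, fun h => ⟨⟨(hP M h).1, h⟩, (hP M h).2⟩⟩

theorem ap_of_restrict_ofCard (h : (C.restrict (C.ofCard θ)).AP θ) : C.AP θ := by
  intro M₀ h₀ M₁ h₁ M₂ h₂ h₀₁ h₀₂
  have hmem := fun M => (mem_ofCard_restrict_iff (C := C) (M := M) (θ := θ) fun _ h => h).2
  obtain ⟨M₃, h₃, f₁, f₂, ⟨_, hi₁, hl₁⟩, ⟨_, hi₂, hl₂⟩, hf⟩ :=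
    h M₀ (hmem _ h₀) M₁ (hmem _ h₁) M₂ (hmem _ h₂) ⟨h₀₁, h₀, h₁⟩ ⟨h₀₂, h₀, h₂⟩
  exact ⟨M₃, h₃.1.2, f₁, f₂, ⟨_, hi₁, hl₁.1⟩, ⟨_, hi₂, hl₂.1⟩, hf⟩

end AbsClass

/-! ### Transfer of the frame axioms to a cofinal subclass. -/

namespace Frame

open Model AbsClass

/-- If `𝔰_{κ⁺}` is a good frame then so is the frame induced on each AEC in `κ⁺` that is cofinal
above its members. -/
theorem IsGood₂.induced {s : Frame L} {κ : Cardinal.{u}} {P : Set (Model L)} (hκ : ℵ₀ ≤ κ)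
    (hs : s.IsSemiGood κ) (hP : ∀ M ∈ P, M ∈ s.C.ofCard (Order.succ κ))
    (hR : (s.C.restrict P).IsAECIn (Order.succ κ))
    (hcof : ∀ M ∈ P, ∀ N ∈ s.C.ofCard (Order.succ κ), s.C.le M N → ∃ N' ∈ P, s.C.le N N')
    (hsucc : (s.succFrame κ).IsGood₂ (Order.succ κ)) :
    (s.induced κ P).IsGood₂ (Order.succ κ) := by
  have hC := hs.1.1
  have hl := hs.2.1
  have hF := hsucc.2
  have hS : (s.C.restrict (s.C.ofCard (Order.succ κ))).IsAECForLengths _ := hsucc.1.2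
  have hκs : κ ≤ Order.succ κ := Order.le_succ κ
  have hap : s.C.AP (Order.succ κ) := ap_of_restrict_ofCard hF.ap
  have memS : ∀ {M}, M ∈ s.C.ofCard (Order.succ κ) →
      M ∈ (s.C.restrict (s.C.ofCard (Order.succ κ))).ofCard (Order.succ κ) :=
    (mem_ofCard_restrict_iff fun _ h => h).2
  have memP : ∀ {M}, M ∈ (s.C.restrict P).ofCard (Order.succ κ) ↔ M ∈ P :=
    mem_ofCard_restrict_iff hP
  have leS : ∀ {M N}, (s.C.restrict P).le M N →
      (s.C.restrict (s.C.ofCard (Order.succ κ))).le M N :=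
    fun h => ⟨h.1, hP _ h.2.1, hP _ h.2.2⟩
  have trS : ∀ {M N a}, (s.C.restrict P).IsTriple M N a →
      (s.C.restrict (s.C.ofCard (Order.succ κ))).IsTriple M N a := fun h => ⟨leS h.1, h.2⟩
  have tpP : ∀ {M N N' a a'}, (s.C.restrict P).IsTriple M N a →
      (s.C.restrict P).IsTriple M N' a' →
      ((s.C.restrict P).tp M N a = (s.C.restrict P).tp M N' a' ↔
        s.C.tp M N a = s.C.tp M N' a') :=
    tp_restrict_eq_iff hC hl hκ hκs hap hR.2 hP hcof
  have tpS : ∀ {M N N' a a'}, (s.C.restrict (s.C.ofCard (Order.succ κ))).IsTriple M N a →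
      (s.C.restrict (s.C.ofCard (Order.succ κ))).IsTriple M N' a' →
      ((s.C.restrict (s.C.ofCard (Order.succ κ))).tp M N a =
        (s.C.restrict (s.C.ofCard (Order.succ κ))).tp M N' a' ↔
        s.C.tp M N a = s.C.tp M N' a') :=
    tp_restrict_eq_iff hC hl hκ hκs hap hS (fun _ h => h)
      (fun _ _ N hN _ => ⟨N, hN, hC.refl _ hN.1⟩)
  -- A type is basic when some representative is; agreement of types with those of K makes this
  -- independent of the representative.
  have bsP : ∀ {M N a}, (s.C.restrict P).IsTriple M N a →
      ((s.C.restrict P).tp M N a ∈ (s.induced κ P).bs M ↔ s.C.tp M N a ∈ s.bsGT κ M) := by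
    intro M N a h
    refine ⟨?_, fun hb => ⟨N, a, h, rfl, hb⟩⟩
    rintro ⟨N', a', h', heq, hb⟩
    rwa [(tpP h h').1 heq]
  have bsS : ∀ {M N a}, (s.C.restrict (s.C.ofCard (Order.succ κ))).IsTriple M N a →
      ((s.C.restrict (s.C.ofCard (Order.succ κ))).tp M N a ∈ (s.succFrame κ).bs M ↔
        s.C.tp M N a ∈ s.bsGT κ M) := by
    intro M N a h
    refine ⟨?_, fun hb => ⟨N, a, h, rfl, hb⟩⟩
    rintro ⟨N', a', h', heq, hb⟩
    rwa [(tpS h h').1 heq]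
  have nfS : ∀ {M₀ M₁ N a}, (s.induced κ P).nf M₀ M₁ a N → (s.succFrame κ).nf M₀ M₁ a N :=
    fun h => ⟨h.1, hP _ h.2.1, hP _ h.2.2.1, hP _ h.2.2.2⟩
  have sortS := hF.nf_sort
  have isoP : ∀ {f M N}, M ∈ P → IsIso f M N → N ∈ P := fun hM hf =>
    (hR.2.iso_mem _ _ _ ⟨(hP _ hM).1, hM⟩ hf).2
  have incS : ∀ {D : Ordinal.{u} → Model L} {δ}, (s.C.restrict P).IncrCont D δ →
      (s.C.restrict (s.C.ofCard (Order.succ κ))).IncrCont D δ := fun h =>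
    ⟨fun α hα => ⟨(h.mem α hα).1, hP _ (h.mem α hα).2⟩,
      fun α β hαβ hβ => leS (h.le α β hαβ hβ), h.cont⟩
  have growS : ∀ {M₀ M₁ a N N'}, (s.succFrame κ).nf M₀ M₁ a N →
      N' ∈ s.C.ofCard (Order.succ κ) → s.C.le N N' → (s.succFrame κ).nf M₀ M₁ a N' := by
    intro M₀ M₁ a N N' h hN' hle
    obtain ⟨h₀, h₁, hN, h₀₁, h₁N, ha, -⟩ := sortS _ _ _ _ h
    exact hF.monotonicity M₀ M₀ M₁ M₁ N N' N' a h₀ h₁ (memS hN') (memS hN')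
      ⟨hC.refl _ h₀.1.1, h₀.1.2, h₀.1.2⟩ h₀₁ ⟨hC.refl _ h₁.1.1, h₁.1.2, h₁.1.2⟩
      ⟨hle, hN.1.2, hN'⟩ ⟨hC.refl _ hN'.1, hN', hN'⟩
      ((hC.sub _ _ h₁N.1).trans (hC.sub _ _ hle)).subset ((hC.sub _ _ hle).subset ha) h
  have tp_grow : ∀ {M N N' a}, s.C.IsTriple M N a → s.C.le N N' →
      s.C.tp M N a = s.C.tp M N' a := by
    intro M N N' a h hle
    have h' : s.C.IsTriple M N' a :=
      ⟨hC.trans _ _ _ h.1 hle, (hC.sub _ _ hle).subset h.2.1, h.2.2⟩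
    exact (tp_eq_iff hC h').2 (.single ⟨h, h', N', id, id, isEmb_id hle,
      isEmb_id (hC.refl _ (s.C.le_mem hle).2), fun _ _ => rfl, fun _ _ => rfl, rfl⟩)
  refine ⟨hR, ?_⟩
  constructor
  case jep =>
    intro M₁ h₁ M₂ h₂
    have h₁' := memP.1 h₁
    have h₂' := memP.1 h₂
    obtain ⟨M₃, h₃, f₁, f₂, hf₁, hf₂⟩ := hF.jep M₁ (memS (hP _ h₁')) M₂ (memS (hP _ h₂'))
    have hf₁ := (isEmb_restrict_iff hS (memS (hP _ h₁')).1 h₃.1.2).1 hf₁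
    have hf₂ := (isEmb_restrict_iff hS (memS (hP _ h₂')).1 h₃.1.2).1 hf₂
    obtain ⟨M, hM, hle⟩ := hf₁
    -- The image M of `M₁` is the member of P below `M₃` that cofinality requires.
    obtain ⟨Y, hY, hXY⟩ := hcof M (isoP h₁' hM) M₃ h₃.1.2 hle
    exact ⟨Y, memP.2 hY, f₁, f₂,
      (isEmb_restrict_iff hR.2 h₁.1 hY).2 (IsEmb.le_right hC ⟨M, hM, hle⟩ hXY),
      (isEmb_restrict_iff hR.2 h₂.1 hY).2 (hf₂.le_right hC hXY)⟩
  case ap =>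
    intro M₀ h₀ M₁ h₁ M₂ h₂ h₀₁ h₀₂
    have h₀' := memP.1 h₀
    obtain ⟨X, hX, f₁, f₂, hf₁, hf₂, hx₁, hx₂⟩ := hap M₀ (hP _ h₀') M₁ (hP _ (memP.1 h₁)) M₂
      (hP _ (memP.1 h₂)) h₀₁.1 h₀₂.1
    obtain ⟨Y, hY, hXY⟩ := hcof M₀ h₀' X hX ((hf₁.le_left hC h₀₁.1).le_of_fixes hx₁)
    exact ⟨Y, memP.2 hY, f₁, f₂, (isEmb_restrict_iff hR.2 h₁.1 hY).2 (hf₁.le_right hC hXY),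
      (isEmb_restrict_iff hR.2 h₂.1 hY).2 (hf₂.le_right hC hXY), hx₁, hx₂⟩
  case noMax =>
    intro M hM
    have hM' := memP.1 hM
    obtain ⟨N, hN, hMN, hne⟩ := hF.noMax M (memS (hP _ hM'))
    obtain ⟨Y, hY, hNY⟩ := hcof M hM' N hN.1.2 hMN.1
    refine ⟨Y, memP.2 hY, ⟨hC.trans _ _ _ hMN.1 hNY, hM', hY⟩, ?_⟩
    rintro rfl
    exact hne ((hC.sub _ _ hMN.1).antisymm (hC.sub _ _ hNY))
  case bs_types =>
    rintro M - p ⟨N, a, h, hp, -⟩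
    exact ⟨N, a, h, hp⟩
  case bs_iso =>
    intro f M N M' N' a hM h hN hMM hb
    have hM' := memP.1 hM
    have hle : s.C.le M' N' := hC.iso_le f _ _ _ _ h.1.1 hN hMM
    have h' : (s.C.restrict P).IsTriple M' N' (f a) := by
      refine ⟨⟨hle, isoP hM' hMM, isoP h.1.2.2 hN⟩, hN.bijOn.mapsTo h.2.1, fun hfa => h.2.2 ?_⟩
      obtain ⟨x, hx, hxa⟩ := hMM.bijOn.surjOn hfa
      rwa [← hN.bijOn.injOn ((hC.sub _ _ h.1.1).subset hx) h.2.1 hxa]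
    exact (bsP h').2 ((bsS (trS h')).1 (hF.bs_iso f M N M' N' a (memS (hP _ hM')) (trS h) hN hMM
      ((bsS (trS h)).2 ((bsP h).1 hb))))
  case density =>
    intro M hM N hN hle hne
    obtain ⟨a, haN, haM, hb⟩ := hF.density M (memS (hP _ (memP.1 hM))) N
      (memS (hP _ (memP.1 hN))) (leS hle) hne
    have h : (s.C.restrict P).IsTriple M N a := ⟨hle, haN, haM⟩
    exact ⟨a, haN, haM, (bsP h).2 ((bsS (trS h)).1 hb)⟩
  case stability =>
    intro M hM
    refine le_trans ?_ (hF.stability M (memS (hP _ (memP.1 hM))))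
    -- Computing the type of a chosen representative in K_{κ⁺} injects the basic types of the
    -- induced frame into those of 𝔰_{κ⁺}.
    choose N a h hp hb using fun p : (s.induced κ P).bs M => p.2
    refine Cardinal.mk_le_of_injective (f := fun p =>
      ⟨(s.C.restrict (s.C.ofCard (Order.succ κ))).tp M (N p) (a p),
        (bsS (trS (h p))).2 (hb p)⟩) fun p q hpq => Subtype.ext ?_
    rw [hp p, hp q]
    exact (tpP (h p) (h q)).2 ((tpS (trS (h p)) (trS (h q))).1 (congrArg Subtype.val hpq))
  case nf_sort =>
    intro M₀ M₁ N a h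
    obtain ⟨h₀, h₁, hN, h₀₁, h₁N, ha, ha₁, hb₀, hb₁⟩ := sortS _ _ _ _ (nfS h)
    have hP₁ : (s.C.restrict P).IsTriple M₁ N a := ⟨⟨h₁N.1, h.2.2⟩, ha, ha₁⟩
    have hP₀ : (s.C.restrict P).IsTriple M₀ N a :=
      ⟨⟨hC.trans _ _ _ h₀₁.1 h₁N.1, h.2.1, h.2.2.2⟩, ha,
        fun hx => ha₁ ((hC.sub _ _ h₀₁.1).subset hx)⟩
    exact ⟨memP.2 h.2.1, memP.2 h.2.2.1, memP.2 h.2.2.2, ⟨h₀₁.1, h.2.1, h.2.2.1⟩, hP₁.1, ha, ha₁,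
      (bsP hP₀).2 ((bsS (trS hP₀)).1 hb₀), (bsP hP₁).2 ((bsS (trS hP₁)).1 hb₁)⟩
  case nf_iso =>
    intro f M₀ M₁ N M₀' M₁' N' a h hN h₀ h₁
    exact ⟨(hF.nf_iso f _ _ _ _ _ _ a (nfS h) hN h₀ h₁).1, isoP h.2.1 h₀, isoP h.2.2.1 h₁,
      isoP h.2.2.2 hN⟩
  case monotonicity =>
    intro M₀ M₀' M₁' M₁ N N' N'' a h₀ h₁ hN' hN'' h₁₂ h₂₃ h₃₄ hNN hNN' hsub ha h
    have m := fun {M} (hM : M ∈ (s.C.restrict P).ofCard (Order.succ κ)) =>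
      memS (hP M (memP.1 hM))
    exact ⟨(hF.monotonicity M₀ M₀' M₁' M₁ N N' N'' a (m h₀) (m h₁) (m hN') (m hN'') (leS h₁₂)
      (leS h₂₃) (leS h₃₄) (leS hNN) (leS hNN') hsub ha (nfS h)).1, memP.1 h₀, memP.1 h₁,
      memP.1 hN''⟩
  case localCharacter =>
    intro δ D N a hδ hlt hD hcard hN h hb
    obtain ⟨α, hα, hnf⟩ := hF.localCharacter δ D N a hδ hlt (incS hD) hcard
      (memS (hP _ (memP.1 hN))) (trS h) ((bsS (trS h)).2 ((bsP h).1 hb))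
    exact ⟨α, hα, hnf.1, (hD.mem α (hα.trans (Order.lt_succ δ))).2, h.1.2.1, h.1.2.2⟩
  case uniqueness =>
    intro M₀ M₁ N N' a a' h h' heq
    have tr₁ : ∀ {N a}, (s.induced κ P).nf M₀ M₁ a N → (s.C.restrict P).IsTriple M₁ N a :=
      fun h => ⟨⟨h.1.2.1.2.1, h.2.2⟩, h.1.2.1.2.2⟩
    have tr₀ : ∀ {N a}, (s.induced κ P).nf M₀ M₁ a N → (s.C.restrict P).IsTriple M₀ N a :=
      fun h => ⟨⟨hC.trans _ _ _ h.1.2.1.1 h.1.2.1.2.1, h.2.1, h.2.2.2⟩, h.1.2.1.2.2.1,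
        fun hx => h.1.2.1.2.2.2 ((hC.sub _ _ h.1.2.1.1).subset hx)⟩
    exact (tpP (tr₁ h) (tr₁ h')).2 ((tpS (trS (tr₁ h)) (trS (tr₁ h'))).1
      (hF.uniqueness _ _ _ _ _ _ (nfS h) (nfS h')
        ((tpS (trS (tr₀ h)) (trS (tr₀ h'))).2 ((tpP (tr₀ h) (tr₀ h')).1 heq))))
  case symmetry =>
    intro M₀ M₁ M₂ a b h₀ h₁ h₂ h₀₁ h₁₂ htr hb hnf
    have hM₀ := memP.1 h₀
    obtain ⟨N, hN, M₃, hM₃, h₀N, hN₃, h₂₃, hbN, hnfa⟩ := hF.symmetry M₀ M₁ M₂ a b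
      (memS (hP _ hM₀)) (memS (hP _ (memP.1 h₁))) (memS (hP _ (memP.1 h₂))) (leS h₀₁) (leS h₁₂)
      (trS htr) ((bsS (trS htr)).2 ((bsP htr).1 hb)) (nfS hnf)
    obtain ⟨-, -, -, -, -, ha₃, haN, hb₃, -⟩ := sortS _ _ _ _ hnfa
    obtain ⟨N', hN', hNN'⟩ := hcof M₀ hM₀ N hN.1.2 h₀N.1
    have hNN's : (s.C.restrict (s.C.ofCard (Order.succ κ))).le N N' := ⟨hNN', hN.1.2, hP _ hN'⟩
    have h₀N' := hC.trans _ _ _ h₀N.1 hNN'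
    -- The element a may lie in N', or its type over N' may fork, so a new realization a'
    -- independent of N' is taken.
    obtain ⟨M₄, a', hnf', htp⟩ := hF.extension M₀ (memS (hP _ hM₀)) N' (memS (hP _ hN'))
      ⟨h₀N', hP _ hM₀, hP _ hN'⟩ _ hb₃
    obtain ⟨-, -, hM₄, -, hN'₄, ha'₄, ha'N', -⟩ := sortS _ _ _ _ hnf'
    have hN₄ := hC.trans _ _ _ hNN' hN'₄.1
    have hnfN : (s.succFrame κ).nf M₀ N a' M₄ :=
      hF.monotonicity M₀ M₀ N N' M₄ M₄ M₄ a' (memS (hP _ hM₀)) hN hM₄ hM₄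
        ⟨hC.refl _ h₀.1.1, hP _ hM₀, hP _ hM₀⟩ h₀N hNN's
        ⟨hC.refl _ hM₄.1.1, hM₄.1.2, hM₄.1.2⟩ ⟨hC.refl _ hM₄.1.1, hM₄.1.2, hM₄.1.2⟩
        (hC.sub _ _ hN₄).subset ha'₄ hnf'
    have tr₃ : (s.C.restrict (s.C.ofCard (Order.succ κ))).IsTriple N M₃ a := ⟨hN₃, ha₃, haN⟩
    have tr₄ : (s.C.restrict (s.C.ofCard (Order.succ κ))).IsTriple N M₄ a' :=
      ⟨⟨hN₄, hN.1.2, hM₄.1.2⟩, ha'₄, fun hx => ha'N' ((hC.sub _ _ hNN').subset hx)⟩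
    -- Both types over N are non-forking extensions of the same type over `M₀`. Hence `M₃` and `M₄`
    -- can be amalgamated over N with a' sent to a, and the image Q of N' is the required model: it
    -- is in P, contains b, and a is independent of it over `M₀`.
    have htpN := (tpS tr₃ tr₄).1 (hF.uniqueness _ _ _ _ _ _ hnfa hnfN htp.symm)
    have hT := (tp_eq_iff hC ⟨tr₄.1.1, tr₄.2⟩).1 htpN
    obtain ⟨X, hX, f₁, f₂, hf₁, hf₂, hx₁, hx₂, hfa⟩ := exists_amalgam_of_transGen hC hl hκ hκs hap
      hN.1.2 hM₃.1.2 hT hM₄.1.2 (hC.refl _ hM₄.1.1) hN₄ ha'₄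
    obtain ⟨Y, g, k, h₃Y, -, hk, hgf, hkg, -⟩ := hf₁.exists_extension hC
    have hY := ofCard_of_isIso hC hk hX
    have hkf : ∀ x ∈ M₃.carrier, k (f₁ x) = x := fun x hx => by
      rw [← hgf x hx, hkg x ((hC.sub _ _ h₃Y).subset hx)]
    obtain ⟨Z, hZ, hZY⟩ := (isEmb_of_isIso hC hk hX.1).comp hC hf₂
    obtain ⟨Q, hQ, hQZ⟩ := exists_le_of_isIso hC hZ hN'₄.1
    have hfix : ∀ x ∈ N.carrier, (k ∘ f₂) x = x := fun x hx => by
      have := hkf x ((hC.sub _ _ hN₃.1).subset hx)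
      rw [hx₁ x hx] at this
      simp only [Function.comp]
      rw [hx₂ x hx, this]
    have hNi : IsIso (k ∘ f₂) N N := (isIso_id N).congr hfix
    have h₀i : IsIso (k ∘ f₂) M₀ M₀ := (isIso_id M₀).congr fun x hx =>
      hfix x ((hC.sub _ _ h₀N.1).subset hx)
    have hNQ : s.C.le N Q := hC.iso_le _ _ _ _ _ hNN' hQ hNi
    have hnfQ := hF.nf_iso _ _ _ _ _ _ _ _ hnf' hZ h₀i hQ
    have hka : (k ∘ f₂) a' = a := (congrArg k hfa).symm.trans (hkf a ha₃)
    rw [hka] at hnfQ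
    -- The ambient model can be enlarged into P freely, since this does not affect non-forking of a
    -- over Q.
    obtain ⟨W, hW, hYW⟩ := hcof M₀ hM₀ Y hY
      (hC.trans _ _ _ h₀N.1 (hC.trans _ _ _ hN₃.1 h₃Y))
    have hQP := isoP hN' hQ
    have hZW := hC.trans _ _ _ hZY hYW
    exact ⟨Q, memP.2 hQP, W, memP.2 hW, ⟨hC.trans _ _ _ h₀N.1 hNQ, hM₀, hQP⟩,
      ⟨hC.trans _ _ _ hQZ hZW, hQP, hW⟩,
      ⟨hC.trans _ _ _ h₂₃.1 (hC.trans _ _ _ h₃Y hYW), memP.1 h₂, hW⟩,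
      (hC.sub _ _ hNQ).subset hbN, (growS hnfQ (hP _ hW) hZW).1, hM₀, hQP, hW⟩
  case extension =>
    rintro M hM N hN hle p ⟨N₁, a, h, rfl, hb⟩
    obtain ⟨N', a', hnf, htp⟩ := hF.extension M (memS (hP _ (memP.1 hM))) N
      (memS (hP _ (memP.1 hN))) (leS hle) _ ((bsS (trS h)).2 hb)
    obtain ⟨-, -, hN', -, hNN', ha, haN, -⟩ := sortS _ _ _ _ hnf
    obtain ⟨Y, hY, hNY⟩ := hcof N (memP.1 hN) N' hN'.1.2 hNN'.1
    have htr : (s.C.restrict (s.C.ofCard (Order.succ κ))).IsTriple M N' a' :=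
      ⟨⟨hC.trans _ _ _ hle.1 hNN'.1, hP _ (memP.1 hM), hN'.1.2⟩, ha,
        fun hx => haN ((hC.sub _ _ hle.1).subset hx)⟩
    have htr' : (s.C.restrict P).IsTriple M Y a' :=
      ⟨⟨hC.trans _ _ _ htr.1.1 hNY, memP.1 hM, hY⟩, (hC.sub _ _ hNY).subset ha, htr.2.2⟩
    refine ⟨Y, a', ⟨(growS hnf (hP _ hY) hNY).1, memP.1 hM, memP.1 hN, hY⟩,
      (tpP htr' h).2 ?_⟩
    rw [← tp_grow ⟨htr.1.1, htr.2⟩ hNY]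
    exact (tpS htr (trS h)).1 htp
  case continuity =>
    intro δ D N a hδ hlt hD hcard hN h hnf
    exact ⟨(hF.continuity δ D N a hδ hlt (incS hD) hcard (memS (hP _ (memP.1 hN))) (trS h)
      fun α hα => nfS (hnf α hα)).1,
      (hD.mem 0 ((bot_lt_iff_ne_bot.2 hδ.ne_bot).trans (Order.lt_succ δ))).2, h.1.2⟩

end Frame

end JardenFrames

theorem mainTheorem11 {L : FirstOrder.Language.{u, u}} (s : JardenFrames.Frame L)
    (κ : Cardinal.{u}) (hκ : Cardinal.aleph0 ≤ κ)
    (hs : s.IsSemiGood κ)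
    (hsat : (s.C.sat κ).IsAECIn (Order.succ κ))
    (hsucc : (s.succFrame κ).IsGood₂ (Order.succ κ)) :
    (s.satFrame κ).IsGood₂ (Order.succ κ) := by
  refine JardenFrames.Frame.IsGood₂.induced hκ hs (fun _ h => h.1) hsat
    (fun M hM N hN hle => ?_) hsucc
  exact JardenFrames.AbsClass.IsSat.exists_extension hs.1.1 hs.2.1 hκ hs.2.2.ap hsat.2 hM hN hle
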